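/- **Setting and conventions.** Let $M$ be a smooth (Hausdorff) manifold of dimension $n\ge 2$ with a projective structure $\boldsymbol p$, that is, a class of torsion-free affine connections modulo $\nabla'_XY=\nabla_XY+\Upsilon(X)Y+\Upsilon(Y)X$ with $\Upsilon$ a one-form. Assume that $\boldsymbol p$ is Einstein: it contains the Levi-Civita connection $\nabla$ of a pseudo-Riemannian metric $g$ with $\mathrm{Ric}=\Lambda g$, $\Lambda\in\mathbb R$. All formulas below are in this Einstein scale, and $\nabla$ is also used on the density bundles $\mathcal E(w)=\big((\Lambda^nT^*M)^2\big)^{-w/(2(n+1))}$, where it preserves the powers of the volume density of $g$; a suffix $(w)$ denotes the tensor product with $\mathcal E(w)$. Round brackets denote symmetrization with unit weight. With $(R(X,Y)Z)^d=R_{ab}{}^d{}_cX^aY^bZ^c$ for the curvature $R(X,Y)=[\nabla_X,\nabla_Y]-\nabla_{[X,Y]}$ and $R_{bc}=R_{ab}{}^a{}_c$ for the Ricci tensor, the projective Schouten tensor is $Q_{bc}=\frac{1}{n^2-1}(nR_{bc}+R_{cb})$, the projective Weyl tensor $W_{ab}{}^d{}_c$ is defined by $$R_{ab}{}^d{}_c=W_{ab}{}^d{}_c+\delta_a^dQ_{bc}-\delta_b^dQ_{ac}-(Q_{ab}-Q_{ba})\delta_c^d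 ,$$ and $W_{abc}{}^d:=g_{ce}W_{ab}{}^e{}_f\,g^{fd}$. A section of the bundle $\mathcal T_{(AB)}$ (the symmetric square of the cotractor bundle of $\boldsymbol p$) is given, for each connection of $\boldsymbol p$, by a triple $(\tau,v_a,w_{ab})$ of sections of $\mathcal E(2)$, $T^*M(2)$ and $\odot^2T^*M(2)$, which changes under $\nabla\mapsto\nabla'$ as above to $(\tau,\ v_a+\Upsilon_a\tau,\ w_{ab}+2\Upsilon_{(a}v_{b)}+\Upsilon_a\Upsilon_b\tau)$. In the Einstein scale the tractor connection is $$\nabla_c(\tau,v_a,w_{ab})=\big(\nabla_c\tau-2v_c,\ \nabla_cv_a+Q_{ca}\tau-w_{ca},\ \nabla_cw_{ab}+2Q_{c(a}v_{b)}\big),$$ and the prolongation connection $\widetilde\nabla$ is obtained from it by adding $-\frac23W_{c(ab)}{}^dv_d$ to the bottom (third) slot. Let $\boldsymbol d^{\widetilde\nabla}$ be its exterior covariant derivative. Define $\mathcal L_0:\mathcal E(2)\to\mathcal T_{(AB)}$, $\mathcal L_1:\odot^3T^*M(2)\to\Lambda^1(\mathcal T_{(AB)})$ and $\mathcal D:\mathcal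 E(2)\to\odot^3T^*M(2)$ on smooth sections by $$\mathcal L_0\sigma=\big(\sigma,\ \tfrac12\nabla_a\sigma,\ (\tfrac12\nabla_a\nabla_b+Q_{ab})\sigma\big),\qquad (\mathcal L_1\psi)_c=(0,0,\psi_{cab}),$$ $$(\mathcal D\sigma)_{abc}=\tfrac12\big[\nabla_{(a}\nabla_b\nabla_{c)}\sigma+4Q_{(ab}\nabla_{c)}\sigma+2(\nabla_{(a}Q_{bc)})\sigma\big].$$ **Lemma.** Under these assumptions the following hold. 1. $\boldsymbol d^{\widetilde\nabla}\circ\mathcal L_0=\mathcal L_1\circ\mathcal D$. 2. The curvature $\widetilde\Omega$ of $\widetilde\nabla$, $\widetilde\Omega(X,Y)=[\widetilde\nabla_X,\widetilde\nabla_Y]-\widetilde\nabla_{[X,Y]}$, is given in the Einstein scale by $$\widetilde\Omega\,(\tau,v_a,w_{ab})=\big(0,\ 0,\ -\tfrac23(\boldsymbol d^{\nabla}\boldsymbol W_{(ab)}{}^c)v_c+2\boldsymbol W_{(a}{}^cw_{b)c}+\tfrac23\boldsymbol W_{(ab)}{}^c\wedge\boldsymbol w_c\big),$$ where $\boldsymbol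 W_{ab}{}^c$ is the one-form $W_{eab}{}^c$ with form index $e$, $\boldsymbol W_a{}^c$ is the two-form $W_{efa}{}^c$ with form indices $e,f$, and $\boldsymbol w_c$ is the one-form $w_{ec}$. That is, the bottom slot of $\widetilde\Omega_{ef}(\tau,v_a,w_{ab})$ is $$-\tfrac23\big(\nabla_eW_{f(ab)}{}^c-\nabla_fW_{e(ab)}{}^c\big)v_c+2W_{ef(a}{}^cw_{b)c}+\tfrac23\big(W_{e(ab)}{}^cw_{fc}-W_{f(ab)}{}^cw_{ec}\big).$$ -/

import Mathlib

open scoped Manifold ContDiff Topology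

set_option linter.unusedSectionVars false

namespace ProjTractor
noncomputable section
open Bundle Module

variable {n : ℕ} {M : Type*} [TopologicalSpace M] [ChartedSpace (EuclideanSpace ℝ (Fin n)) M]
  [IsManifold (𝓡 n) ∞ M]

variable (n M) in
/-- Smooth real-valued functions on the `n`-manifold `M`. -/
abbrev Fn := C^∞⟮𝓡 n, M; ℝ⟯

/-- A real number as a constant function. -/
abbrev cst (r : ℝ) : Fn n M := algebraMap ℝ (Fn n M) r

variable (n M) in
/-- Smooth vector fields on the `n`-manifold `M`. -/
abbrev VF := Cₛ^∞⟮𝓡 n; EuclideanSpace ℝ (Fin n), (TangentSpace (𝓡 n) : M → Type _)⟯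

instance : SMul (Fn n M) (VF n M) :=
  ⟨fun f X => ⟨fun x => f x • X x, f.contMDiff.smul_section X.contMDiff⟩⟩

@[simp] lemma vf_smul_apply (f : Fn n M) (X : VF n M) (x : M) : (f • X) x = f x • X x := rfl

instance : Module (Fn n M) (VF n M) where
  one_smul X := by ext x; simp
  mul_smul f g X := by ext x; simp [mul_smul]
  smul_zero f := by ext x; simp
  smul_add f X Y := by ext x; simp
  add_smul f g X := by ext x; simp [add_smul]
  zero_smul X := by ext x; simp

lemma fn_mdiff (f : Fn n M) (x : M) : MDifferentiableAt (𝓡 n) 𝓘(ℝ, ℝ) f x :=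
  f.contMDiff.mdifferentiableAt (by simp)

/-- The derivative `X f` of a function `f` along a vector field `X`. -/
def dir (X : VF n M) (f : Fn n M) : Fn n M :=
  ⟨fun x => mvfderiv (𝓡 n) f x (X x), by
    have h1 : ContMDiff (𝓡 n).tangent 𝓘(ℝ, ℝ).tangent ∞ (tangentMap (𝓡 n) 𝓘(ℝ, ℝ) f) :=
      f.contMDiff.contMDiff_tangentMap (by simp)
    exact (contMDiff_snd_tangentBundle_modelSpace ℝ 𝓘(ℝ, ℝ)).comp (h1.comp X.contMDiff)⟩

lemma dir_apply (X : VF n M) (f : Fn n M) (x : M) :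
    dir X f x = mvfderiv (𝓡 n) f x (X x) := rfl

lemma dir_add_left (X Y : VF n M) (f : Fn n M) : dir (X + Y) f = dir X f + dir Y f := by
  ext x; simp [dir_apply]

lemma dir_smul_left (h : Fn n M) (X : VF n M) (f : Fn n M) : dir (h • X) f = h * dir X f := by
  ext x; simp [dir_apply]

lemma dir_add (X : VF n M) (f g : Fn n M) : dir X (f + g) = dir X f + dir X g := by
  ext x
  have := mvfderiv_add (fn_mdiff f x) (fn_mdiff g x)
  simpa [dir_apply] using congrArg (fun L => L (X x)) this

lemma dir_mul (X : VF n M) (f g : Fn n M) : dir X (f * g) = dir X f * g + f * dir X g := by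
  ext x
  have := congrArg (fun L => L (X x)) (mvfderiv_mul (fn_mdiff f x) (fn_mdiff g x))
  simp only [dir_apply, ContMDiffMap.coe_mul, ContMDiffMap.coe_add, Pi.add_apply, Pi.mul_apply]
  rw [this]
  simp
  ring

lemma isManifold_minSmoothness : IsManifold (𝓡 n) (minSmoothness ℝ 2) M := by
  rw [minSmoothness_of_isRCLikeNormedField]; infer_instance

lemma inverse_apply_self {V W : Type*} [TopologicalSpace V] [AddCommGroup V] [Module ℝ V]
    [TopologicalSpace W] [AddCommGroup W] [Module ℝ W] {A : V →L[ℝ] W} (hA : A.IsInvertible)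
    (w : W) : A (A.inverse w) = w := by
  obtain ⟨L, rfl⟩ := hA
  simp

/-- The Lie bracket of smooth vector fields. -/
def bracket (X Y : VF n M) : VF n M :=
  ⟨VectorField.mlieBracket (𝓡 n) X Y, fun x => by
    have := isManifold_minSmoothness (n := n) (M := M)
    have : IsManifold (𝓡 n) (((⊤ : ℕ∞) : ℕ∞ω) + 1) M := by
      have h : (((⊤ : ℕ∞) : ℕ∞ω) + 1) = ∞ := by simp
      rw [h]; infer_instance
    exact ContMDiffAt.mlieBracket_vectorField (m := ⊤) (n := ⊤) (X.contMDiff x) (Y.contMDiff x)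
      (by simp [minSmoothness_of_isRCLikeNormedField])⟩

/-- A vector field read in the chart at `x₀`. -/
def inChart (x₀ : M) (V : VF n M) : EuclideanSpace ℝ (Fin n) → EuclideanSpace ℝ (Fin n) :=
  VectorField.mpullbackWithin 𝓘(ℝ, EuclideanSpace ℝ (Fin n)) (𝓡 n)
        (extChartAt (𝓡 n) x₀).symm V (Set.range (𝓡 n))

lemma chart_deriv (x₀ : M) (V : VF n M) (h : Fn n M) {y : EuclideanSpace ℝ (Fin n)}
    (hy : y ∈ (extChartAt (𝓡 n) x₀).target) :
    fderiv ℝ (h ∘ (extChartAt (𝓡 n) x₀).symm) y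
      (inChart x₀ V y) =
      dir V h ((extChartAt (𝓡 n) x₀).symm y) := by
  have hinv := isInvertible_mfderivWithin_extChartAt_symm (I := 𝓡 n) hy
  have hd : MDifferentiableWithinAt 𝓘(ℝ, EuclideanSpace ℝ (Fin n)) (𝓡 n)
      (extChartAt (𝓡 n) x₀).symm (Set.range (𝓡 n)) y := mdifferentiableWithinAt_extChartAt_symm hy
  unfold inChart
  simp only [ModelWithCorners.range_eq_univ, mfderivWithin_univ, mdifferentiableWithinAt_univ,
    VectorField.mpullbackWithin_univ] at hinv hd ⊢
  have hc := mfderiv_comp y (fn_mdiff h _) hd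
  rw [mfderiv_eq_fderiv] at hc
  rw [VectorField.mpullback_apply]
  have h2 := DFunLike.congr_fun hc
    ((mfderiv 𝓘(ℝ, EuclideanSpace ℝ (Fin n)) (𝓡 n) (extChartAt (𝓡 n) x₀).symm y).inverse
            (V ((extChartAt (𝓡 n) x₀).symm y)))
  refine h2.trans ?_
  exact congrArg (mfderiv (𝓡 n) 𝓘(ℝ, ℝ) h ((extChartAt (𝓡 n) x₀).symm y))
    (inverse_apply_self hinv _)

lemma dir_bracket (X Y : VF n M) (f : Fn n M) :
    dir (bracket X Y) f = dir X (dir Y f) - dir Y (dir X f) := by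
  ext x
  set φ := extChartAt (𝓡 n) x with hφ
  have hxm : x ∈ φ.source := mem_extChartAt_source x
  have hym : φ x ∈ φ.target := φ.map_source hxm
  have hsx : φ.symm (φ x) = x := φ.left_inv hxm
  -- the chart is invertible at `x`
  have hinv : (mfderiv (𝓡 n) 𝓘(ℝ, EuclideanSpace ℝ (Fin n)) φ x).IsInvertible :=
    isInvertible_mfderiv_extChartAt hxm
  have hφd : MDifferentiableAt (𝓡 n) 𝓘(ℝ, EuclideanSpace ℝ (Fin n)) φ x :=
    mdifferentiableAt_extChartAt (mem_chart_source _ x)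
  have hopen : φ.target ∈ 𝓝 (φ x) := by
    have := extChartAt_target_mem_nhds (I := 𝓡 n) x
    exact this
  have hfc (h : Fn n M) : ContDiffAt ℝ ∞ (h ∘ φ.symm) (φ x) := by
    have h1 : ContMDiffAt 𝓘(ℝ, EuclideanSpace ℝ (Fin n)) (𝓡 n) ∞ φ.symm (φ x) :=
      (contMDiffOn_extChartAt_symm x).contMDiffAt hopen
    exact ((h.contMDiff _).comp (φ x) h1).contDiffAt
  have hloc (h : Fn n M) : (h : M → ℝ) =ᶠ[𝓝 x] (h ∘ φ.symm) ∘ φ := by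
    filter_upwards [extChartAt_source_mem_nhds (I := 𝓡 n) x] with y hy
    simp only [Function.comp]
    rw [φ.left_inv hy]
  have hVd (V : VF n M) : DifferentiableAt ℝ (inChart x V) (φ x) := by
    have := MDifferentiableWithinAt.differentiableWithinAt_mpullbackWithin_vectorField
      (I := 𝓡 n) (s := Set.univ) (x := x) (V := V) (V.mdifferentiableAt).mdifferentiableWithinAt
    rw [← differentiableWithinAt_univ]
    have hu : (↑(extChartAt (𝓡 n) x).symm ⁻¹' Set.univ ∩ Set.range ↑(𝓡 n)) = Set.univ := by
      simp
    rw [hu] at this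
    exact this
  have key := VectorField.fderiv_apply_lieBracket (hfc f)
    (by rw [minSmoothness_of_isRCLikeNormedField]; exact ENat.LEInfty.out) (hVd Y) (hVd X)
  have e2 (V W : VF n M) : fderiv ℝ (fun y => fderiv ℝ (f ∘ φ.symm) y (inChart x V y)) (φ x)
      (inChart x W (φ x)) = dir W (dir V f) x := by
    have : (fun y => fderiv ℝ (f ∘ φ.symm) y (inChart x V y)) =ᶠ[𝓝 (φ x)]
        (dir V f) ∘ φ.symm := by
      filter_upwards [hopen] with y hy
      exact chart_deriv x V f hy
    rw [this.fderiv_eq, chart_deriv x W (dir V f) hym, hsx]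
  rw [e2, e2] at key
  rw [ContMDiffMap.coe_sub, Pi.sub_apply, ← key]
  have hc := mfderiv_comp x (g := f ∘ φ.symm) (I' := 𝓘(ℝ, EuclideanSpace ℝ (Fin n)))
    (I'' := 𝓘(ℝ, ℝ)) (I := 𝓡 n) (f := φ)
    ((hfc f).differentiableAt (by simp)).mdifferentiableAt hφd
  rw [← (hloc f).mfderiv_eq] at hc
  have hb : (bracket X Y) x = (mfderiv (𝓡 n) 𝓘(ℝ, EuclideanSpace ℝ (Fin n)) φ x).inverse
      (VectorField.lieBracket ℝ (inChart x X) (inChart x Y) (φ x)) := by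
    change VectorField.mlieBracket (𝓡 n) X Y x = _
    have hu : (↑(extChartAt (𝓡 n) x).symm ⁻¹' Set.univ ∩ Set.range ↑(𝓡 n)) = Set.univ := by
      simp
    unfold VectorField.mlieBracket VectorField.mlieBracketWithin
    rw [hu]
    have hw : VectorField.lieBracketWithin ℝ (inChart x X) (inChart x Y) Set.univ (φ x) =
        VectorField.lieBracket ℝ (inChart x X) (inChart x Y) (φ x) := by
      rw [VectorField.lieBracketWithin_univ]
    exact congrArg (fun v : EuclideanSpace ℝ (Fin n) =>
      (mfderiv (𝓡 n) 𝓘(ℝ, EuclideanSpace ℝ (Fin n)) φ x).inverse v) hw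
  rw [dir_apply, hb]
  have h2 := DFunLike.congr_fun hc
    ((mfderiv (𝓡 n) 𝓘(ℝ, EuclideanSpace ℝ (Fin n)) φ x).inverse
      (VectorField.lieBracket ℝ (inChart x X) (inChart x Y) (φ x)))
  refine h2.trans ?_
  refine (congrArg (mfderiv 𝓘(ℝ, EuclideanSpace ℝ (Fin n)) 𝓘(ℝ, ℝ) (f ∘ φ.symm) (φ x))
    (inverse_apply_self hinv _)).trans ?_
  rw [mfderiv_eq_fderiv]
  rfl

lemma bracket_swap (X Y : VF n M) : bracket X Y = - bracket Y X := by
  ext x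
  exact VectorField.mlieBracket_swap_apply

lemma bracket_add_left (X X' Y : VF n M) :
    bracket (X + X') Y = bracket X Y + bracket X' Y := by
  ext x
  exact VectorField.mlieBracket_add_left X.mdifferentiableAt X'.mdifferentiableAt

lemma bracket_smul_left (f : Fn n M) (X Y : VF n M) :
    bracket (f • X) Y = f • bracket X Y - dir Y f • X := by
  ext x
  refine (VectorField.mlieBracket_smul_left (fn_mdiff f x) X.mdifferentiableAt).trans ?_
  simp [dir_apply, sub_eq_add_neg, add_comm]
  rfl

variable (n M) in
/-- A smooth torsion-free affine connection on `M`. -/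
structure AffineConnection where
  /-- the covariant derivative on the tangent bundle -/
  cov : CovariantDerivative (𝓡 n) (EuclideanSpace ℝ (Fin n)) (TangentSpace (𝓡 n) : M → Type _)
  smooth : CovariantDerivative.ContMDiffCovariantDerivative cov ∞
  torsion_eq_zero : cov.torsion = 0

namespace AffineConnection

variable (D : AffineConnection n M)

/-- `∇_X Y` for smooth vector fields `X` and `Y`. -/
def nabla (X Y : VF n M) : VF n M :=
  ⟨fun x => D.cov Y x (X x), by
    have h := D.smooth.contMDiff.contMDiff (σ := Y) (by simpa using Y.contMDiff.contMDiffOn)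
    exact (contMDiffOn_univ.1 h).clm_bundle_apply X.contMDiff⟩

lemma nabla_add_left (X X' Y : VF n M) : D.nabla (X + X') Y = D.nabla X Y + D.nabla X' Y := by
  ext x
  exact (D.cov Y x).map_add (X x) (X' x)

lemma nabla_smul_left (f : Fn n M) (X Y : VF n M) : D.nabla (f • X) Y = f • D.nabla X Y := by
  ext x
  exact (D.cov Y x).map_smul (f x) (X x)

lemma nabla_add_right (X Y Y' : VF n M) : D.nabla X (Y + Y') = D.nabla X Y + D.nabla X Y' := by
  ext x
  exact DFunLike.congr_fun (D.cov.isCovariantDerivativeOnUniv.add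
    Y.mdifferentiableAt Y'.mdifferentiableAt) (X x)

lemma nabla_smul_right (f : Fn n M) (X Y : VF n M) :
    D.nabla X (f • Y) = f • D.nabla X Y + dir X f • Y := by
  ext x
  exact DFunLike.congr_fun (D.cov.isCovariantDerivativeOnUniv.leibniz
    Y.mdifferentiableAt (fn_mdiff f x)) (X x)

lemma nabla_sub_nabla (X Y : VF n M) : D.nabla X Y - D.nabla Y X = bracket X Y := by
  ext x
  exact (D.cov.torsion_eq_zero_iff.1 D.torsion_eq_zero) X.mdifferentiableAt Y.mdifferentiableAt

end AffineConnection

/-- Constructor for trilinear maps. -/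
def mkTrilin {R V W : Type*} [CommRing R] [AddCommGroup V] [Module R V] [AddCommGroup W]
    [Module R W] (f : V → V → V → W)
    (a₁ : ∀ x x' y z, f (x + x') y z = f x y z + f x' y z)
    (s₁ : ∀ (r : R) x y z, f (r • x) y z = r • f x y z)
    (a₂ : ∀ x y y' z, f x (y + y') z = f x y z + f x y' z)
    (s₂ : ∀ (r : R) x y z, f x (r • y) z = r • f x y z)
    (a₃ : ∀ x y z z', f x y (z + z') = f x y z + f x y z')
    (s₃ : ∀ (r : R) x y z, f x y (r • z) = r • f x y z) : V →ₗ[R] V →ₗ[R] V →ₗ[R] W where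
  toFun x := LinearMap.mk₂ R (f x) (a₂ x) (fun r => s₂ r x) (a₃ x) (fun r => s₃ r x)
  map_add' x x' := by ext y z; exact a₁ x x' y z
  map_smul' r x := by ext y z; exact s₁ r x y z

@[simp] lemma mkTrilin_apply {R V W : Type*} [CommRing R] [AddCommGroup V] [Module R V]
    [AddCommGroup W] [Module R W] (f : V → V → V → W) (a₁ s₁ a₂ s₂ a₃ s₃) (x y z : V) :
    mkTrilin (R := R) f a₁ s₁ a₂ s₂ a₃ s₃ x y z = f x y z := rfl

namespace AffineConnection
variable (D : AffineConnection n M)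

/-- The curvature `R(X,Y)Z = ∇_X ∇_Y Z - ∇_Y ∇_X Z - ∇_[X,Y] Z`; in index notation
`(R(X,Y)Z)^d = R_{ab}{}^d{}_c X^a Y^b Z^c`, so that `[∇_a,∇_b] ω_c = - R_{ab}{}^d{}_c ω_d`. -/
def curvature : VF n M →ₗ[Fn n M] VF n M →ₗ[Fn n M] VF n M →ₗ[Fn n M] VF n M := by
  have anti : ∀ X Y Z, D.nabla X (D.nabla Y Z) - D.nabla Y (D.nabla X Z) - D.nabla (bracket X Y) Z
      = - (D.nabla Y (D.nabla X Z) - D.nabla X (D.nabla Y Z) - D.nabla (bracket Y X) Z) := by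
    intro X Y Z
    have : D.nabla (bracket X Y) Z = - D.nabla (bracket Y X) Z := by
      have h := D.nabla_smul_left (-1) (bracket Y X) Z
      rw [bracket_swap]; simpa using h
    rw [this]; abel
  have a₁ : ∀ X X' Y Z, D.nabla (X + X') (D.nabla Y Z) - D.nabla Y (D.nabla (X + X') Z)
      - D.nabla (bracket (X + X') Y) Z = (D.nabla X (D.nabla Y Z) - D.nabla Y (D.nabla X Z)
        - D.nabla (bracket X Y) Z) + (D.nabla X' (D.nabla Y Z) - D.nabla Y (D.nabla X' Z)
        - D.nabla (bracket X' Y) Z) := by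
    intro X X' Y Z
    simp only [bracket_add_left, nabla_add_left, nabla_add_right]
    abel
  have nsl : ∀ (X Y Z : VF n M), D.nabla (X - Y) Z = D.nabla X Z - D.nabla Y Z := by
    intro X Y Z
    have h := D.nabla_smul_left (-1) Y Z
    rw [sub_eq_add_neg, nabla_add_left, sub_eq_add_neg]
    simpa using h
  have s₁ : ∀ (f : Fn n M) X Y Z, D.nabla (f • X) (D.nabla Y Z) - D.nabla Y (D.nabla (f • X) Z)
      - D.nabla (bracket (f • X) Y) Z = f • (D.nabla X (D.nabla Y Z) - D.nabla Y (D.nabla X Z)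
        - D.nabla (bracket X Y) Z) := by
    intro f X Y Z
    simp only [bracket_smul_left, nsl, nabla_smul_left, nabla_smul_right, smul_sub]
    abel
  exact mkTrilin (fun X Y Z => D.nabla X (D.nabla Y Z) - D.nabla Y (D.nabla X Z)
      - D.nabla (bracket X Y) Z) a₁ s₁
    (fun X Y Y' Z => by
      simp only [anti X]
      rw [a₁]; abel)
    (fun f X Y Z => by
      simp only [anti X]
      rw [s₁, smul_neg])
    (fun X Y Z Z' => by
      simp only [nabla_add_right]; abel)
    (fun f X Y Z => by
      simp only [nabla_add_right, nabla_smul_right, dir_bracket, smul_sub, sub_smul]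
      abel)

lemma curvature_apply (X Y Z : VF n M) : D.curvature X Y Z =
    D.nabla X (D.nabla Y Z) - D.nabla Y (D.nabla X Z) - D.nabla (bracket X Y) Z := rfl

end AffineConnection

section Trace
variable [T2Space M]

/-- Around each point there are global vector fields `e i` and global one-forms `c i` which near
the point form a frame and its dual coframe. -/
lemma exists_local_frame (x₀ : M) : ∃ (e : Fin n → VF n M) (c : Fin n → VF n M →ₗ[Fn n M] Fn n M),
    ∀ᶠ y in 𝓝 x₀, ∃ b : Basis (Fin n) ℝ (TangentSpace (𝓡 n) y),
      (∀ i, b i = e i y) ∧ ∀ (Z : VF n M) i, b.repr (Z y) i = c i Z y := by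
  let t := trivializationAt (EuclideanSpace ℝ (Fin n)) (TangentSpace (𝓡 n) : M → Type _) x₀
  let b₀ : Basis (Fin n) ℝ (EuclideanSpace ℝ (Fin n)) := (EuclideanSpace.basisFun (Fin n) ℝ).toBasis
  let χ : SmoothBumpFunction (𝓡 n) x₀ := Classical.arbitrary _
  have hbase : t.baseSet = (chartAt (EuclideanSpace ℝ (Fin n)) x₀).source :=
    TangentBundle.trivializationAt_baseSet x₀
  have hs (i : Fin n) := t.contMDiffOn_localFrame_baseSet (I := 𝓡 n) ∞ b₀ i
  let e : Fin n → VF n M := fun i => ⟨(χ : M → ℝ) • t.localFrame b₀ i,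
    ContMDiffOn.smul_section_of_tsupport χ.contMDiff.contMDiffOn t.open_baseSet
      (hbase ▸ χ.tsupport_subset_chartAt_source) (hs i)⟩
  have hc (i : Fin n) (Z : VF n M) : ContMDiff (𝓡 n) 𝓘(ℝ, ℝ) ∞
      (fun x => χ x • t.localFrameCoeff (𝓡 n) b₀ i x (Z x)) := by
    apply χ.contMDiff_smul
    rw [← hbase]
    exact contMDiffOn_baseSet_localFrameCoeff b₀ Z.contMDiff.contMDiffOn i
  let c : Fin n → VF n M →ₗ[Fn n M] Fn n M := fun i =>
    { toFun := fun Z => ⟨_, hc i Z⟩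
      map_add' := fun Z Z' => by
        ext x
        change χ x * t.localFrameCoeff (𝓡 n) b₀ i x (Z x + Z' x) = χ x *
          t.localFrameCoeff (𝓡 n) b₀ i x (Z x) + χ x * t.localFrameCoeff (𝓡 n) b₀ i x (Z' x)
        rw [map_add, mul_add]
      map_smul' := fun f Z => by
        ext x
        change χ x * t.localFrameCoeff (𝓡 n) b₀ i x (f x • Z x) =
          f x * (χ x * t.localFrameCoeff (𝓡 n) b₀ i x (Z x))
        rw [map_smul, smul_eq_mul]; ring }
  refine ⟨e, c, ?_⟩
  filter_upwards [t.open_baseSet.mem_nhds (FiberBundle.mem_baseSet_trivializationAt' x₀),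
    χ.eventuallyEq_one] with y hy hχ
  refine ⟨t.basisAt b₀ hy, fun i => ?_, fun Z i => ?_⟩
  · change _ = χ y • t.localFrame b₀ i y
    rw [hχ, t.localFrame_apply_of_mem_baseSet b₀ hy]
    simp
  · change _ = χ y • t.localFrameCoeff (𝓡 n) b₀ i y (Z y)
    rw [hχ, t.localFrameCoeff_apply_of_mem_baseSet b₀ hy]
    simp

lemma vf_sum_apply {ι : Type*} (s : Finset ι) (F : ι → VF n M) (x : M) :
    (∑ i ∈ s, F i) x = ∑ i ∈ s, F i x := by
  have := map_sum (ContMDiffSection.coeAddHom (𝓡 n) (EuclideanSpace ℝ (Fin n)) ∞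
    (TangentSpace (𝓡 n) : M → Type _)) F s
  exact (congrFun this x).trans (by simp)

/-- Evaluation of smooth functions at a point, as a ring homomorphism. -/
def evalAt (x : M) : Fn n M →+* ℝ where
  toFun f := f x
  map_one' := rfl
  map_mul' _ _ := rfl
  map_zero' := rfl
  map_add' _ _ := rfl

lemma evalAt_apply (x : M) (f : Fn n M) : evalAt x f = f x := rfl

/-- A vector field vanishing at a point is, up to a cutoff function, a combination of vector fields
with coefficients vanishing at the point. -/
lemma exists_cutoff (X : VF n M) {x : M} (hX : X x = 0) :
    ∃ (ψ : Fn n M) (f : Fin n → Fn n M) (e : Fin n → VF n M),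
      ψ x = 1 ∧ (∀ i, f i x = 0) ∧ ψ • X = ∑ i, f i • e i := by
  obtain ⟨e, c, h⟩ := exists_local_frame (n := n) x
  obtain ⟨χ, -, hχ⟩ := ((SmoothBumpFunction.nhds_basis_tsupport (I := 𝓡 n) x).mem_iff).1 h
  let ψ : Fn n M := ⟨χ, χ.contMDiff⟩
  obtain ⟨b, hb, hb'⟩ := h.self_of_nhds
  refine ⟨ψ, fun i => c i X, fun i => ψ • e i, χ.eq_one, fun i => ?_, ?_⟩
  · rw [← hb', hX]
    simp
  · ext y
    rw [vf_sum_apply, vf_smul_apply]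
    simp only [vf_smul_apply]
    by_cases hy : y ∈ tsupport χ
    · obtain ⟨b, hb, hb'⟩ := hχ hy
      conv_lhs => rw [← b.sum_repr (X y)]
      rw [Finset.smul_sum]
      refine Finset.sum_congr rfl fun i _ => ?_
      rw [hb, hb', smul_comm]
    · have : ψ y = 0 := image_eq_zero_of_notMem_tsupport hy
      simp [this]

/-- A `C^∞(M)`-linear endomorphism of the vector fields acts pointwise. -/
lemma endo_apply_eq_zero (A : VF n M →ₗ[Fn n M] VF n M) {X : VF n M} {x : M} (hX : X x = 0) :
    A X x = 0 := by
  obtain ⟨ψ, f, e, hψ, hf, h⟩ := exists_cutoff X hX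
  have h2 := congrArg (fun Y => (A Y) x) h
  simp only [map_smul, map_sum, vf_sum_apply, vf_smul_apply, hψ, hf] at h2
  simpa using h2

/-- A `C^∞(M)`-linear functional on the vector fields acts pointwise. -/
lemma form_apply_eq_zero (A : VF n M →ₗ[Fn n M] Fn n M) {X : VF n M} {x : M} (hX : X x = 0) :
    A X x = 0 := by
  obtain ⟨ψ, f, e, hψ, hf, h⟩ := exists_cutoff X hX
  have h2 := congrArg (fun Y => evalAt x (A Y)) h
  simp only [map_smul, map_sum, smul_eq_mul, map_mul] at h2
  simpa [evalAt_apply, hψ, hf] using h2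

lemma exists_extension (x : M) (v : TangentSpace (𝓡 n) x) : ∃ X : VF n M, X x = v := by
  obtain ⟨e, c, h⟩ := exists_local_frame (n := n) x
  obtain ⟨b, hb, -⟩ := h.self_of_nhds
  refine ⟨∑ i, b.repr v i • e i, ?_⟩
  rw [vf_sum_apply]
  have h (i) : ((b.repr v i • e i : VF n M)) x = b.repr v i • b i := by rw [hb]; rfl
  simp only [h]
  exact b.sum_repr v

/-- The endomorphism of the tangent space at `x` induced by a `C^∞(M)`-linear endomorphism of the
vector fields. -/
def endoAt (A : VF n M →ₗ[Fn n M] VF n M) (x : M) :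
    TangentSpace (𝓡 n) x →ₗ[ℝ] TangentSpace (𝓡 n) x where
  toFun v := A (exists_extension x v).choose x
  map_add' v w := by
    rw [← sub_eq_zero]
    have := endo_apply_eq_zero A (x := x) (X := (exists_extension x (v + w)).choose
      - ((exists_extension x v).choose + (exists_extension x w).choose)) (by
        simp [(exists_extension x (v + w)).choose_spec, (exists_extension x v).choose_spec,
          (exists_extension x w).choose_spec])
    simpa using this
  map_smul' r v := by
    rw [← sub_eq_zero]
    let f : Fn n M := ContMDiffMap.const r
    have hf : f x = r := rfl
    have := endo_apply_eq_zero A (x := x) (X := (exists_extension x (r • v)).choose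
      - f • (exists_extension x v).choose) (by
        simp [(exists_extension x (r • v)).choose_spec, (exists_extension x v).choose_spec, hf])
    simpa [hf] using this

lemma endoAt_apply (A : VF n M →ₗ[Fn n M] VF n M) (X : VF n M) (x : M) :
    endoAt A x (X x) = A X x := by
  rw [← sub_eq_zero]
  have := endo_apply_eq_zero A (x := x) (X := (exists_extension x (X x)).choose - X) (by
        simp [(exists_extension x (X x)).choose_spec])
  change A (exists_extension x (X x)).choose x - A X x = 0
  simpa using this

/-- The pointwise trace of a `C^∞(M)`-linear endomorphism of the vector fields. -/
def trace : (VF n M →ₗ[Fn n M] VF n M) →ₗ[Fn n M] Fn n M where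
  toFun A := ⟨fun x => LinearMap.trace ℝ (TangentSpace (𝓡 n) x) (endoAt A x), fun x₀ => by
    obtain ⟨e, c, h⟩ := exists_local_frame (n := n) x₀
    have hsm : ContMDiffAt (𝓡 n) 𝓘(ℝ, ℝ) ∞ (∑ i, c i (A (e i)) : Fn n M) x₀ :=
      (∑ i, c i (A (e i)) : Fn n M).contMDiff x₀
    refine hsm.congr_of_eventuallyEq ?_
    filter_upwards [h] with y ⟨b, hb, hb'⟩
    rw [LinearMap.trace_eq_matrix_trace ℝ b, Matrix.trace]
    have hsum : (∑ i, c i (A (e i)) : Fn n M) y = ∑ i, c i (A (e i)) y := by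
      simpa using congrFun (map_sum (ContMDiffMap.coeFnAddMonoidHom (I := 𝓡 n) (N := M)
        (I' := 𝓘(ℝ, ℝ)) (G := ℝ) (n := ∞)) (fun i => c i (A (e i))) Finset.univ) y
    rw [hsum]
    refine Finset.sum_congr rfl fun i _ => ?_
    rw [Matrix.diag_apply, LinearMap.toMatrix_apply, hb, endoAt_apply, hb']⟩
  map_add' A B := by
    ext x
    have : endoAt (A + B) x = endoAt A x + endoAt B x := rfl
    change LinearMap.trace ℝ _ (endoAt (A + B) x) =
      LinearMap.trace ℝ _ (endoAt A x) + LinearMap.trace ℝ _ (endoAt B x)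
    rw [this, map_add]
  map_smul' f A := by
    ext x
    have : endoAt (f • A) x = f x • endoAt A x := rfl
    change LinearMap.trace ℝ _ (endoAt (f • A) x) = f x • LinearMap.trace ℝ _ (endoAt A x)
    rw [this, map_smul]

namespace AffineConnection
variable (D : AffineConnection n M)

/-- The Ricci tensor `R_{bc} = R_{ab}{}^a{}_c`, the trace of `X ↦ R(X,Y)Z`. -/
def ricci : VF n M →ₗ[Fn n M] VF n M →ₗ[Fn n M] Fn n M :=
  LinearMap.mk₂ (Fn n M) (fun Y Z => trace ((D.curvature.flip Y).flip Z))
    (fun Y Y' Z => by rw [← map_add]; congr 1; ext X : 1; simp)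
    (fun f Y Z => by rw [← map_smul]; congr 1; ext X : 1; simp)
    (fun Y Z Z' => by rw [← map_add]; congr 1; ext X : 1; simp)
    (fun f Y Z => by rw [← map_smul]; congr 1; ext X : 1; simp)

/-- The projective Schouten tensor `Q_{bc} = (n R_{bc} + R_{cb}) / (n² - 1)`. -/
def schouten : VF n M →ₗ[Fn n M] VF n M →ₗ[Fn n M] Fn n M :=
  (cst (1 / ((n : ℝ) ^ 2 - 1)) : Fn n M) • ((cst (n : ℝ) : Fn n M) • D.ricci + D.ricci.flip)

/-- The projective Weyl tensor `(W(X,Y)Z)^d = W_{ab}{}^d{}_c X^a Y^b Z^c`, defined by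
`R_{ab}{}^d{}_c = W_{ab}{}^d{}_c + δ_a^d Q_{bc} - δ_b^d Q_{ac} - (Q_{ab} - Q_{ba}) δ_c^d`. -/
def weyl : VF n M →ₗ[Fn n M] VF n M →ₗ[Fn n M] VF n M →ₗ[Fn n M] VF n M :=
  mkTrilin (fun X Y Z => D.curvature X Y Z - (D.schouten Y Z • X - D.schouten X Z • Y
      - (D.schouten X Y - D.schouten Y X) • Z))
    (fun X X' Y Z => by simp only [map_add, LinearMap.add_apply]; module)
    (fun f X Y Z => by simp only [map_smul, LinearMap.smul_apply, smul_eq_mul]; module)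
    (fun X Y Y' Z => by simp only [map_add, LinearMap.add_apply]; module)
    (fun f X Y Z => by simp only [map_smul, LinearMap.smul_apply, smul_eq_mul]; module)
    (fun X Y Z Z' => by simp only [map_add]; module)
    (fun f X Y Z => by simp only [map_smul, smul_eq_mul]; module)

end AffineConnection
end Trace

variable (n M) in
/-- A smooth pseudo-Riemannian metric on `M`, of any signature. -/
structure PseudoRiemannianMetric where
  /-- the scalar product on each tangent space -/
  val : ∀ x : M, LinearMap.BilinForm ℝ (TangentSpace (𝓡 n) x)
  symm : ∀ x v w, val x v w = val x w v
  nondegenerate : ∀ x, (val x).Nondegenerate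
  smooth : ∀ X Y : VF n M, ContMDiff (𝓡 n) 𝓘(ℝ, ℝ) ∞ (fun x => val x (X x) (Y x))

variable (n M) in
/-- Smooth densities of projective weight `w`, the sections of `((Λⁿ T*M)²)^(-w/(2(n+1)))`, viewed as
functions on the frames of the tangent spaces. Smoothness means that the value on a local
smooth frame depends smoothly on the point. -/
@[ext]
structure Density (w : ℝ) where
  /-- the value on a basis of a tangent space -/
  toFun : ∀ x : M, Basis (Fin n) ℝ (TangentSpace (𝓡 n) x) → ℝ
  transform : ∀ x b b', toFun x b' = |b.det b'| ^ (-w / (n + 1)) * toFun x b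
  smooth : ∀ (e : Fin n → VF n M) (x₀ : M), LinearIndependent ℝ (fun i => e i x₀) →
    ∃ f : M → ℝ, ContMDiffAt (𝓡 n) 𝓘(ℝ, ℝ) ∞ f x₀ ∧ ∀ᶠ y in 𝓝 x₀,
      ∀ b : Basis (Fin n) ℝ (TangentSpace (𝓡 n) y), (∀ i, b i = e i y) → toFun y b = f y

namespace Density
variable {w : ℝ}

instance : Zero (Density n M w) :=
  ⟨⟨fun _ _ => 0, by simp, fun _ _ _ => ⟨fun _ => 0, contMDiffAt_const, by simp⟩⟩⟩

instance : Add (Density n M w) :=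
  ⟨fun φ ψ => ⟨fun x b => φ.toFun x b + ψ.toFun x b,
    fun x b b' => by rw [φ.transform x b b', ψ.transform x b b']; ring, fun e x₀ he => by
      obtain ⟨f, hf, h⟩ := φ.smooth e x₀ he
      obtain ⟨k, hk, h'⟩ := ψ.smooth e x₀ he
      refine ⟨fun y => f y + k y, hf.add hk, ?_⟩
      filter_upwards [h, h'] with y hy hy' b hb
      rw [hy b hb, hy' b hb]⟩⟩

instance : SMul (Fn n M) (Density n M w) :=
  ⟨fun k φ => ⟨fun x b => k x * φ.toFun x b,
    fun x b b' => by rw [φ.transform x b b']; ring, fun e x₀ he => by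
      obtain ⟨f, hf, h⟩ := φ.smooth e x₀ he
      refine ⟨fun y => k y * f y, (k.contMDiff x₀).mul hf, ?_⟩
      filter_upwards [h] with y hy b hb
      rw [hy b hb]⟩⟩

instance : Neg (Density n M w) := ⟨fun φ => (-1 : Fn n M) • φ⟩

lemma add_toFun (φ ψ : Density n M w) (x b) :
    (φ + ψ).toFun x b = φ.toFun x b + ψ.toFun x b := rfl

lemma smul_toFun (k : Fn n M) (φ : Density n M w) (x b) :
    (k • φ).toFun x b = k x * φ.toFun x b := rfl

lemma zero_toFun (x b) : (0 : Density n M w).toFun x b = 0 := rfl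

lemma neg_toFun (φ : Density n M w) (x b) : (-φ).toFun x b = - φ.toFun x b :=
  neg_one_mul (φ.toFun x b)

instance : AddCommGroup (Density n M w) :=
  { AddGroup.ofLeftAxioms (G := Density n M w)
      (fun a b c => by ext x f; simp only [add_toFun]; ring)
      (fun a => by ext x f; simp only [add_toFun, zero_toFun]; ring)
      (fun a => by ext x f; simp only [add_toFun, zero_toFun, neg_toFun]; ring) with
    add_comm := fun a b => by ext x f; simp only [add_toFun]; ring }

instance : Module (Fn n M) (Density n M w) where
  one_smul φ := by ext x b; exact one_mul (φ.toFun x b)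
  mul_smul f g φ := by ext x b; exact mul_assoc (f x) (g x) (φ.toFun x b)
  smul_zero f := by ext x b; exact mul_zero (f x)
  smul_add f φ ψ := by ext x b; exact mul_add (f x) (φ.toFun x b) (ψ.toFun x b)
  add_smul f g φ := by ext x b; exact add_mul (f x) (g x) (φ.toFun x b)
  zero_smul φ := by ext x b; exact zero_mul (φ.toFun x b)

end Density

section Metric
variable [T2Space M]

instance (x : M) : FiniteDimensional ℝ (TangentSpace (𝓡 n) x) :=
  inferInstanceAs (FiniteDimensional ℝ (EuclideanSpace ℝ (Fin n)))

/-- The linear form on the tangent space at `x` induced by a `C^∞(M)`-linear functional on the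
vector fields. -/
lemma exists_form_at (A : VF n M →ₗ[Fn n M] Fn n M) (x : M) :
    ∃ a : Dual ℝ (TangentSpace (𝓡 n) x), ∀ X : VF n M, a (X x) = A X x := by
  have key : ∀ X Y : VF n M, X x = Y x → A X x = A Y x := by
    intro X Y h
    rw [← sub_eq_zero]
    have := form_apply_eq_zero A (X := X - Y) (x := x) (by simp [h])
    simpa using this
  refine ⟨{ toFun := fun v => A (exists_extension x v).choose x, map_add' := ?_, map_smul' := ?_ },
    ?_⟩
  · intro v w
    have h := key (exists_extension x (v + w)).choose
      ((exists_extension x v).choose + (exists_extension x w).choose) (by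
        rw [(exists_extension x (v + w)).choose_spec]
        simp [(exists_extension x v).choose_spec, (exists_extension x w).choose_spec])
    simpa using h
  · intro r v
    have h := key (exists_extension x (r • v)).choose
      ((cst r : Fn n M) • (exists_extension x v).choose) (by
        rw [(exists_extension x (r • v)).choose_spec]
        simp only [vf_smul_apply, (exists_extension x v).choose_spec]
        rfl)
    rw [h, map_smul]
    rfl
  · intro X
    exact key _ _ (exists_extension x (X x)).choose_spec

namespace PseudoRiemannianMetric
variable (g : PseudoRiemannianMetric n M)

/-- The metric as a bilinear form on vector fields. -/
def form : VF n M →ₗ[Fn n M] VF n M →ₗ[Fn n M] Fn n M :=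
  LinearMap.mk₂ (Fn n M) (fun X Y => ⟨fun x => g.val x (X x) (Y x), g.smooth X Y⟩)
    (fun X X' Y => by
      ext x
      change g.val x (X x + X' x) (Y x) = g.val x (X x) (Y x) + g.val x (X' x) (Y x)
      simp)
    (fun f X Y => by
      ext x
      change g.val x (f x • X x) (Y x) = f x * g.val x (X x) (Y x)
      simp)
    (fun X Y Y' => by
      ext x
      change g.val x (X x) (Y x + Y' x) = g.val x (X x) (Y x) + g.val x (X x) (Y' x)
      simp)
    (fun f X Y => by
      ext x
      change g.val x (X x) (f x • Y x) = f x * g.val x (X x) (Y x)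
      simp)

lemma form_apply (X Y : VF n M) (x : M) : g.form X Y x = g.val x (X x) (Y x) := rfl

/-- The Gram determinant of the metric in a basis of a tangent space. -/
def gram (x : M) (b : Basis (Fin n) ℝ (TangentSpace (𝓡 n) x)) : ℝ :=
  (Matrix.of fun i j => g.val x (b i) (b j)).det

lemma gram_eq (x : M) (b : Basis (Fin n) ℝ (TangentSpace (𝓡 n) x)) :
    g.gram x b = (LinearMap.BilinForm.toMatrix b (g.val x)).det := by
  unfold gram
  congr 1
  ext i j
  rw [LinearMap.BilinForm.toMatrix_apply]; rfl

lemma gram_ne_zero (x : M) (b : Basis (Fin n) ℝ (TangentSpace (𝓡 n) x)) : g.gram x b ≠ 0 := by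
  rw [gram_eq]
  exact (LinearMap.BilinForm.nondegenerate_iff_det_ne_zero b).1 (g.nondegenerate x)

lemma gram_transform (x : M) (b b' : Basis (Fin n) ℝ (TangentSpace (𝓡 n) x)) :
    g.gram x b' = (b.det b') ^ 2 * g.gram x b := by
  rw [gram_eq, gram_eq, ← LinearMap.BilinForm.toMatrix_mul_basis_toMatrix b b', Matrix.det_mul,
    Matrix.det_mul, Matrix.det_transpose, Basis.det_apply]
  ring

lemma gram_frame (e : Fin n → VF n M) (x : M) (b : Basis (Fin n) ℝ (TangentSpace (𝓡 n) x))
    (hb : ∀ i, b i = e i x) :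
    g.gram x b = (Matrix.of fun i j => g.form (e i) (e j)).det x := by
  rw [← evalAt_apply, RingHom.map_det]
  unfold gram
  congr 1
  ext i j
  simp [evalAt_apply, form_apply, hb]

lemma form_bijective : Function.Bijective g.form := by
  constructor
  · intro X Y h
    ext x
    rw [← sub_eq_zero]
    refine (g.nondegenerate x).1 _ fun v => ?_
    obtain ⟨Z, rfl⟩ := exists_extension x v
    rw [map_sub, LinearMap.sub_apply, ← form_apply, ← form_apply, h, sub_self]
  · intro A
    have hex : ∀ x : M, ∃ v : TangentSpace (𝓡 n) x, ∀ Z : VF n M, g.val x v (Z x) = A Z x := by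
      intro x
      obtain ⟨a, ha⟩ := exists_form_at A x
      refine ⟨((g.val x).toDual (g.nondegenerate x)).symm a, fun Z => ?_⟩
      rw [LinearMap.BilinForm.apply_toDual_symm_apply, ha]
    choose v hv using hex
    refine ⟨⟨v, fun x₀ => ?_⟩, ?_⟩
    · obtain ⟨e, c, h⟩ := exists_local_frame (n := n) x₀
      let G : Matrix (Fin n) (Fin n) (Fn n M) := Matrix.of fun i j => g.form (e i) (e j)
      let V : VF n M := ∑ i, (∑ j, G.adjugate i j * A (e j)) • e i
      obtain ⟨b₀, hb₀, -⟩ := h.self_of_nhds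
      have hdet : ContMDiffAt (𝓡 n) 𝓘(ℝ, ℝ) ∞ (fun y => (G.det y)⁻¹) x₀ := by
        have h0 : G.det x₀ ≠ 0 := by
          rw [← g.gram_frame e x₀ b₀ hb₀]; exact g.gram_ne_zero x₀ b₀
        exact (contDiffAt_inv ℝ h0).contMDiffAt.comp x₀ (G.det.contMDiff x₀)
      have hs := hdet.smul_section (V.contMDiff x₀)
      refine hs.congr_of_eventuallyEq ?_
      filter_upwards [h] with y ⟨b, hb, hb'⟩
      have h0 : G.det y ≠ 0 := by
        rw [← g.gram_frame e y b hb]; exact g.gram_ne_zero y b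
      have hvV : v y = (G.det y)⁻¹ • V y := by
        rw [← sub_eq_zero]
        suffices hz : g.val y (v y - (G.det y)⁻¹ • V y) = 0 from
          (g.nondegenerate y).1 _ fun w => by rw [hz, LinearMap.zero_apply]
        refine b.ext fun k => ?_
        rw [hb, map_sub, LinearMap.sub_apply, hv, map_smul, LinearMap.smul_apply,
          ← form_apply, smul_eq_mul, LinearMap.zero_apply, sub_eq_zero,
          eq_inv_mul_iff_mul_eq₀ h0]
        have hG : ∀ i j, G i j = G j i := by
          intro i j
          ext z
          exact g.symm z _ _
        have : g.form V (e k) = G.det * A (e k) := by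
          have h1 : ∀ j, ∑ i, G.adjugate i j * G i k = if k = j then G.det else 0 := by
            intro j
            have := congrFun (congrFun G.mul_adjugate k) j
            rw [Matrix.mul_apply, Matrix.smul_apply, Matrix.one_apply] at this
            simp only [smul_eq_mul, mul_ite, mul_one, mul_zero] at this
            rw [← this]
            exact Finset.sum_congr rfl fun i _ => by rw [hG i k, mul_comm]
          simp only [V, map_sum, map_smul, LinearMap.sum_apply, LinearMap.smul_apply, smul_eq_mul]
          have h2 : ∀ i, (∑ j, G.adjugate i j * A (e j)) * g.form (e i) (e k) =
              ∑ j, (G.adjugate i j * G i k) * A (e j) := by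
            intro i
            rw [Finset.sum_mul]
            exact Finset.sum_congr rfl fun j _ => by simp only [G, Matrix.of_apply]; ring
          simp only [h2]
          rw [Finset.sum_comm]
          simp only [← Finset.sum_mul, h1]
          simp
        rw [this]; rfl
      exact congrArg (fun u => (⟨y, u⟩ : TotalSpace (EuclideanSpace ℝ (Fin n))
        (TangentSpace (𝓡 n) : M → Type _))) hvV
    · ext Z x
      exact hv x Z

/-- The index raising isomorphism: `g.form (g.sharp α) Z = α Z`. -/
def sharp : (VF n M →ₗ[Fn n M] Fn n M) ≃ₗ[Fn n M] VF n M :=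
  (LinearEquiv.ofBijective g.form g.form_bijective).symm

lemma form_sharp (α : VF n M →ₗ[Fn n M] Fn n M) (Z : VF n M) : g.form (g.sharp α) Z = α Z :=
  DFunLike.congr_fun ((LinearEquiv.ofBijective g.form g.form_bijective).apply_symm_apply α) Z

/-- The metric volume density to the power `-w/(n+1)`, on a frame. -/
def scaleVal (w : ℝ) (x : M) (b : Basis (Fin n) ℝ (TangentSpace (𝓡 n) x)) : ℝ :=
  (√|g.gram x b|) ^ (-w / (n + 1))

lemma scaleVal_pos (w : ℝ) (x : M) (b : Basis (Fin n) ℝ (TangentSpace (𝓡 n) x)) :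
    0 < g.scaleVal w x b :=
  Real.rpow_pos_of_pos (Real.sqrt_pos.2 (abs_pos.2 (g.gram_ne_zero x b))) _

lemma scaleVal_transform (w : ℝ) (x : M) (b b' : Basis (Fin n) ℝ (TangentSpace (𝓡 n) x)) :
    g.scaleVal w x b' = |b.det b'| ^ (-w / (n + 1)) * g.scaleVal w x b := by
  unfold scaleVal
  rw [g.gram_transform x b b', abs_mul, abs_pow, Real.sqrt_mul (by positivity),
    Real.sqrt_sq (abs_nonneg _), Real.mul_rpow (abs_nonneg _) (Real.sqrt_nonneg _)]

lemma exists_scaleVal (w : ℝ) (e : Fin n → VF n M) (x₀ : M)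
    (he : LinearIndependent ℝ (fun i => e i x₀)) :
    ∃ f : M → ℝ, ContMDiffAt (𝓡 n) 𝓘(ℝ, ℝ) ∞ f x₀ ∧ f x₀ ≠ 0 ∧ ∀ y : M,
      ∀ b : Basis (Fin n) ℝ (TangentSpace (𝓡 n) y), (∀ i, b i = e i y) →
        g.scaleVal w y b = f y := by
  let G : Matrix (Fin n) (Fin n) (Fn n M) := Matrix.of fun i j => g.form (e i) (e j)
  let b₀ : Basis (Fin n) ℝ (TangentSpace (𝓡 n) x₀) := 
    Basis.mk he (he.span_eq_top_of_card_eq_finrank' (by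
      have : finrank ℝ (TangentSpace (𝓡 n) x₀) = finrank ℝ (EuclideanSpace ℝ (Fin n)) := rfl
      simp [this])).ge
  have hb₀ : ∀ i, b₀ i = e i x₀ := fun i => by simp [b₀]
  have h0 : G.det x₀ ≠ 0 := by
    rw [← g.gram_frame e x₀ b₀ hb₀]; exact g.gram_ne_zero x₀ b₀
  have habs : |G.det x₀| ≠ 0 := abs_ne_zero.2 h0
  refine ⟨fun y => (√|G.det y|) ^ (-w / (n + 1)), ?_, ?_, ?_⟩
  · have : ContDiffAt ℝ ∞ (fun t : ℝ => (√|t|) ^ (-w / (n + 1))) (G.det x₀) :=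
      ((contDiffAt_abs h0).sqrt habs).rpow_const_of_ne (by positivity)
    exact this.contMDiffAt.comp x₀ (G.det.contMDiff x₀)
  · positivity
  · intro y b hb
    rw [scaleVal, g.gram_frame e y b hb]

/-- The density `f · vol_g^(-w/(n+1))` of weight `w`. -/
def toDensity (w : ℝ) (f : Fn n M) : Density n M w where
  toFun x b := f x * g.scaleVal w x b
  transform x b b' := by rw [g.scaleVal_transform w x b b']; ring
  smooth e x₀ he := by
    obtain ⟨k, hk, -, h⟩ := g.exists_scaleVal w e x₀ he
    refine ⟨fun y => f y * k y, (f.contMDiff x₀).mul hk, ?_⟩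
    exact Filter.Eventually.of_forall fun y b hb => by rw [h y b hb]

lemma toDensity_toFun (w : ℝ) (f : Fn n M) (x b) :
    (g.toDensity w f).toFun x b = f x * g.scaleVal w x b := rfl

/-- The trivialisation of the densities of weight `w` by the metric volume density: it sends a
function `f` to `f · vol_g^(-w/(n+1))`. -/
def triv (w : ℝ) : Fn n M ≃ₗ[Fn n M] Density n M w :=
  LinearEquiv.ofBijective
    { toFun := g.toDensity w
      map_add' := fun f k => by
        ext x b
        simp only [Density.add_toFun, toDensity_toFun, ContMDiffMap.coe_add, Pi.add_apply]
        ring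
      map_smul' := fun f k => by
        ext x b
        simp only [Density.smul_toFun, toDensity_toFun, smul_eq_mul, ContMDiffMap.coe_mul,
          Pi.mul_apply, RingHom.id_apply]
        ring } <| by
    constructor
    · intro f k h
      ext x
      have h1 := congrFun (congrFun (congrArg Density.toFun h) x)
        (EuclideanSpace.basisFun (Fin n) ℝ).toBasis
      exact mul_right_cancel₀ (g.scaleVal_pos w x _).ne' (h1 : f x * g.scaleVal w x _ = k x * g.scaleVal w x _)
    · intro φ
      let b₁ : ∀ x : M, Basis (Fin n) ℝ (TangentSpace (𝓡 n) x) := fun x =>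
        (EuclideanSpace.basisFun (Fin n) ℝ).toBasis
      have hind : ∀ x b, φ.toFun x b / g.scaleVal w x b =
          φ.toFun x (b₁ x) / g.scaleVal w x (b₁ x) := by
        intro x b
        rw [φ.transform x (b₁ x) b, g.scaleVal_transform w x (b₁ x) b]
        refine mul_div_mul_left _ _ ?_
        have : (b₁ x).det b ≠ 0 := ((b₁ x).isUnit_det b).ne_zero
        positivity
      refine ⟨⟨fun x => φ.toFun x (b₁ x) / g.scaleVal w x (b₁ x), fun x₀ => ?_⟩, ?_⟩
      · obtain ⟨e, c, h⟩ := exists_local_frame (n := n) x₀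
        obtain ⟨b₀, hb₀, -⟩ := h.self_of_nhds
        have he : LinearIndependent ℝ (fun i => e i x₀) := by
          have : (fun i => e i x₀) = b₀ := funext fun i => (hb₀ i).symm
          rw [this]; exact b₀.linearIndependent
        obtain ⟨k, hk, hk0, hk'⟩ := g.exists_scaleVal w e x₀ he
        obtain ⟨f, hf, hf'⟩ := φ.smooth e x₀ he
        refine (hf.div₀ hk hk0).congr_of_eventuallyEq ?_
        filter_upwards [h, hf'] with y ⟨b, hb, _⟩ hy
        rw [← hind y b, hy b hb, hk' y b hb]; rfl
      · ext x b
        change φ.toFun x (b₁ x) / g.scaleVal w x (b₁ x) * g.scaleVal w x b = _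
        rw [← hind x b]
        exact div_mul_cancel₀ _ (g.scaleVal_pos w x b).ne'

end PseudoRiemannianMetric
end Metric

/-- `D'` is obtained from `D` by the projective change `∇'_X Y = ∇_X Y + Υ(X) Y + Υ(Y) X`. -/
def IsProjectiveChange (Υ : VF n M →ₗ[Fn n M] Fn n M) (D D' : AffineConnection n M) : Prop :=
  ∀ X Y, D'.nabla X Y = D.nabla X Y + Υ X • Y + Υ Y • X

/-- Projective equivalence of torsion-free affine connections. -/
instance projectiveSetoid : Setoid (AffineConnection n M) where
  r D D' := ∃ Υ, IsProjectiveChange Υ D D'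
  iseqv :=
    { refl := fun D => ⟨0, fun X Y => by simp⟩
      symm := fun ⟨Υ, h⟩ => ⟨-Υ, fun X Y => by rw [h]; simp only [LinearMap.neg_apply]; module⟩
      trans := fun ⟨Υ, h⟩ ⟨Υ', h'⟩ => ⟨Υ + Υ', fun X Y => by
        rw [h', h]; simp only [LinearMap.add_apply]; module⟩ }

variable (n M) in
/-- A projective structure: a projective equivalence class of torsion-free affine connections. -/
abbrev ProjectiveStructure := Quotient (projectiveSetoid (n := n) (M := M))

variable (n M) in
/-- A linear connection on a `C^∞(M)`-module `V` (of sections of a vector bundle). Here `d s X` is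
`∇_X s`; one-forms with values in `V` are `C^∞(M)`-linear maps from the vector fields to `V`, so `d`
is also the exterior covariant derivative `d^∇` on zero-forms with values in `V`. -/
structure LinearConnection (V : Type*) [AddCommGroup V] [Module (Fn n M) V] where
  /-- the covariant derivative -/
  d : V → VF n M →ₗ[Fn n M] V
  d_add : ∀ s t, d (s + t) = d s + d t
  d_smul : ∀ (f : Fn n M) s X, d (f • s) X = f • d s X + dir X f • s

namespace LinearConnection
variable {V W : Type*} [AddCommGroup V] [Module (Fn n M) V] [AddCommGroup W] [Module (Fn n M) W]

/-- The curvature `Ω(X,Y) s = ∇_X ∇_Y s - ∇_Y ∇_X s - ∇_[X,Y] s`. -/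
def curv (C : LinearConnection n M V) (X Y : VF n M) (s : V) : V :=
  C.d (C.d s Y) X - C.d (C.d s X) Y - C.d s (bracket X Y)

/-- Transport of a connection along an isomorphism. -/
def transport (C : LinearConnection n M V) (e : V ≃ₗ[Fn n M] W) : LinearConnection n M W where
  d s := e.toLinearMap ∘ₗ C.d (e.symm s)
  d_add s t := by ext X; simp [C.d_add]
  d_smul f s X := by simp [C.d_smul]

/-- The connection obtained by adding a one-form with values in the endomorphisms. -/
def addTerm (C : LinearConnection n M V) (B : V →ₗ[Fn n M] VF n M →ₗ[Fn n M] V) :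
    LinearConnection n M V where
  d s := C.d s + B s
  d_add s t := by rw [C.d_add, map_add]; abel
  d_smul f s X := by
    rw [map_smul, LinearMap.add_apply, LinearMap.add_apply, LinearMap.smul_apply, C.d_smul]
    module

variable (n M) in
/-- The derivative of functions. -/
def ofFn : LinearConnection n M (Fn n M) where
  d f :=
    { toFun := fun X => dir X f
      map_add' := fun X Y => dir_add_left X Y f
      map_smul' := fun h X => dir_smul_left h X f }
  d_add f g := by ext1 X; exact dir_add X f g
  d_smul f g X := by
    change dir X (f * g) = f * dir X g + dir X f * g
    rw [dir_mul]; ring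

/-- An affine connection as a connection on vector fields. -/
def ofAffine (D : AffineConnection n M) : LinearConnection n M (VF n M) where
  d Y :=
    { toFun := fun X => D.nabla X Y
      map_add' := fun X X' => D.nabla_add_left X X' Y
      map_smul' := fun f X => D.nabla_smul_left f X Y }
  d_add Y Y' := by ext1 X; exact D.nabla_add_right X Y Y'
  d_smul f Y X := D.nabla_smul_right f X Y

/-- The connection induced on one-forms with values in `V`,
`(∇_X ω)(Y) = ∇_X (ω(Y)) - ω(∇_X Y)`. -/
def hom (C : LinearConnection n M V) (D : AffineConnection n M) :
    LinearConnection n M (VF n M →ₗ[Fn n M] V) where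
  d α := LinearMap.mk₂ (Fn n M) (fun X Y => C.d (α Y) X - α (D.nabla X Y))
    (fun X X' Y => by rw [D.nabla_add_left, map_add, map_add]; abel)
    (fun f X Y => by rw [D.nabla_smul_left, map_smul, map_smul, smul_sub])
    (fun X Y Y' => by
      rw [D.nabla_add_right, map_add, map_add, C.d_add, LinearMap.add_apply]; abel)
    (fun f X Y => by
      rw [D.nabla_smul_right, map_add, map_smul, map_smul, map_smul, C.d_smul, smul_sub]; abel)
  d_add α β := by
    ext X Y
    simp only [LinearMap.mk₂_apply, LinearMap.add_apply, C.d_add]; abel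
  d_smul f α X := by
    ext Y
    simp only [LinearMap.mk₂_apply, LinearMap.add_apply, LinearMap.smul_apply, C.d_smul, smul_sub]
    abel

lemma hom_apply (C : LinearConnection n M V) (D : AffineConnection n M)
    (α : VF n M →ₗ[Fn n M] V) (X Y : VF n M) :
    (C.hom D).d α X Y = C.d (α Y) X - α (D.nabla X Y) := rfl

end LinearConnection

section Tensors
variable {V : Type*} [AddCommGroup V] [Module (Fn n M) V]

variable (n M V) in
/-- Symmetric bilinear forms on vector fields with values in `V`. -/
def SymForm2 : Submodule (Fn n M) (VF n M →ₗ[Fn n M] VF n M →ₗ[Fn n M] V) where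
  carrier := {b | ∀ X Y, b X Y = b Y X}
  add_mem' hb hc X Y := by simp [hb X Y, hc X Y]
  zero_mem' X Y := by simp
  smul_mem' f b hb X Y := by simp [hb X Y]

variable (n M V) in
/-- Symmetric trilinear forms on vector fields with values in `V`. -/
def SymForm3 : Submodule (Fn n M)
    (VF n M →ₗ[Fn n M] VF n M →ₗ[Fn n M] VF n M →ₗ[Fn n M] V) where
  carrier := {t | ∀ X Y Z, t X Y Z = t Y X Z ∧ t X Y Z = t X Z Y}
  add_mem' hb hc X Y Z := by
    constructor
    · simp [(hb X Y Z).1, (hc X Y Z).1]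
    · simp [(hb X Y Z).2, (hc X Y Z).2]
  zero_mem' X Y Z := by simp
  smul_mem' f b hb X Y Z := by
    constructor
    · simp [(hb X Y Z).1]
    · simp [(hb X Y Z).2]

/-- The symmetrisation `b_{(ab)}`. -/
def sym2 : (VF n M →ₗ[Fn n M] VF n M →ₗ[Fn n M] V) →ₗ[Fn n M] SymForm2 n M V where
  toFun b := ⟨(cst (1 / 2) : Fn n M) • (b + b.flip), fun X Y => by
    simp only [LinearMap.smul_apply, LinearMap.add_apply, LinearMap.flip_apply]
    rw [add_comm]⟩
  map_add' b c := by
    ext X Y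
    simp only [LinearMap.smul_apply, LinearMap.add_apply, LinearMap.flip_apply, Submodule.coe_add]
    module
  map_smul' f b := by
    ext X Y
    simp only [LinearMap.smul_apply, LinearMap.add_apply, LinearMap.flip_apply,
      Submodule.coe_smul, RingHom.id_apply]
    module

lemma sym2_apply (b : VF n M →ₗ[Fn n M] VF n M →ₗ[Fn n M] V) (X Y : VF n M) :
    (sym2 b).1 X Y = (cst (1 / 2) : Fn n M) • (b X Y + b Y X) := rfl

/-- The symmetrisation `t_{(abc)}`. -/
def sym3 (t : VF n M →ₗ[Fn n M] VF n M →ₗ[Fn n M] VF n M →ₗ[Fn n M] V) : SymForm3 n M V :=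
  ⟨mkTrilin (fun X Y Z => (cst (1 / 6) : Fn n M) •
      (t X Y Z + t Y Z X + t Z X Y + t X Z Y + t Z Y X + t Y X Z))
    (fun X X' Y Z => by simp only [map_add, LinearMap.add_apply]; module)
    (fun f X Y Z => by simp only [map_smul, LinearMap.smul_apply]; module)
    (fun X Y Y' Z => by simp only [map_add, LinearMap.add_apply]; module)
    (fun f X Y Z => by simp only [map_smul, LinearMap.smul_apply]; module)
    (fun X Y Z Z' => by simp only [map_add, LinearMap.add_apply]; module)
    (fun f X Y Z => by simp only [map_smul, LinearMap.smul_apply]; module),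
  fun X Y Z => by
    constructor
    · simp only [mkTrilin_apply]
      congr 1; abel
    · simp only [mkTrilin_apply]
      congr 1; abel⟩

/-- The connection induced on symmetric bilinear forms with values in `V`. -/
def LinearConnection.symForm2 (C : LinearConnection n M V) (D : AffineConnection n M) :
    LinearConnection n M (SymForm2 n M V) where
  d w := LinearMap.codRestrict (SymForm2 n M V) (((C.hom D).hom D).d w.1) (fun X Y Z => by
    simp only [hom_apply, LinearMap.sub_apply]
    rw [w.2 Y Z, w.2 (D.nabla X Y), w.2 Y]
    abel)
  d_add w u := by
    ext1 X
    exact Subtype.ext (DFunLike.congr_fun (((C.hom D).hom D).d_add w.1 u.1) X)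
  d_smul f w X := Subtype.ext (((C.hom D).hom D).d_smul f w.1 X)

end Tensors

variable (n M) in
/-- The sections of `T_(AB)` in a choice of connection of the projective class: triples
`(τ, v_a, w_{ab})` with `τ ∈ E(2)`, `v_a ∈ T*M(2)` and `w_{ab} ∈ ⊙²T*M(2)`. -/
structure Slots where
  /-- the top slot -/
  top : Density n M 2
  /-- the middle slot -/
  mid : VF n M →ₗ[Fn n M] Density n M 2
  /-- the bottom slot -/
  bot : SymForm2 n M (Density n M 2)

namespace Slots

lemma ext {s t : Slots n M} (h₁ : s.top = t.top) (h₂ : ∀ X, s.mid X = t.mid X)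
    (h₃ : ∀ X Y, s.bot.1 X Y = t.bot.1 X Y) : s = t := by
  obtain ⟨a, b, c⟩ := s
  obtain ⟨a', b', c'⟩ := t
  obtain rfl : a = a' := h₁
  obtain rfl : b = b' := LinearMap.ext h₂
  obtain rfl : c = c' := Subtype.ext (LinearMap.ext₂ h₃)
  rfl

instance : Zero (Slots n M) := ⟨⟨0, 0, 0⟩⟩
instance : Add (Slots n M) := ⟨fun s t => ⟨s.top + t.top, s.mid + t.mid, s.bot + t.bot⟩⟩
instance : Neg (Slots n M) := ⟨fun s => ⟨-s.top, -s.mid, -s.bot⟩⟩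
instance : SMul (Fn n M) (Slots n M) := ⟨fun f s => ⟨f • s.top, f • s.mid, f • s.bot⟩⟩

lemma ext' {s t : Slots n M} (h₁ : s.top = t.top) (h₂ : s.mid = t.mid) (h₃ : s.bot = t.bot) :
    s = t := by
  obtain ⟨a, b, c⟩ := s
  obtain ⟨a', b', c'⟩ := t
  obtain rfl : a = a' := h₁
  obtain rfl : b = b' := h₂
  obtain rfl : c = c' := h₃
  rfl

instance : AddCommGroup (Slots n M) :=
  { AddGroup.ofLeftAxioms (G := Slots n M)
      (fun a b c => ext' (add_assoc a.top b.top c.top) (add_assoc a.mid b.mid c.mid)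
        (add_assoc a.bot b.bot c.bot))
      (fun a => ext' (zero_add a.top) (zero_add a.mid) (zero_add a.bot))
      (fun a => ext' (neg_add_cancel a.top) (neg_add_cancel a.mid)
        (Subtype.ext (neg_add_cancel a.bot.1))) with
    add_comm := fun a b => ext' (add_comm a.top b.top) (add_comm a.mid b.mid)
      (add_comm a.bot b.bot) }

instance : Module (Fn n M) (Slots n M) where
  one_smul s := ext' (one_smul _ s.top) (one_smul _ s.mid) (one_smul _ s.bot)
  mul_smul f g s := ext' (mul_smul f g s.top) (mul_smul f g s.mid) (mul_smul f g s.bot)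
  smul_zero f := ext' (smul_zero f) (smul_zero f) (smul_zero f)
  smul_add f s t := ext' (smul_add f s.top t.top) (smul_add f s.mid t.mid) (smul_add f s.bot t.bot)
  add_smul f g s := ext' (add_smul f g s.top) (add_smul f g s.mid) (add_smul f g s.bot)
  zero_smul s := ext' (zero_smul _ s.top) (zero_smul _ s.mid) (Subtype.ext (zero_smul _ s.bot.1))

lemma add_top (s t : Slots n M) : (s + t).top = s.top + t.top := rfl
lemma add_mid (s t : Slots n M) : (s + t).mid = s.mid + t.mid := rfl
lemma add_bot (s t : Slots n M) : (s + t).bot = s.bot + t.bot := rfl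
lemma smul_top (f : Fn n M) (s : Slots n M) : (f • s).top = f • s.top := rfl
lemma smul_mid (f : Fn n M) (s : Slots n M) : (f • s).mid = f • s.mid := rfl
lemma smul_bot (f : Fn n M) (s : Slots n M) : (f • s).bot = f • s.bot := rfl

variable (n M) in
/-- The insertion `w ↦ (0, 0, w)` into the bottom slot. -/
def insertBot : SymForm2 n M (Density n M 2) →ₗ[Fn n M] Slots n M where
  toFun w := ⟨0, 0, w⟩
  map_add' _ _ := ext' (add_zero _).symm (add_zero _).symm rfl
  map_smul' f _ := ext' (smul_zero f).symm (smul_zero f).symm rfl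

/-- The change of the slots under a projective change of the connection, the symmetric square of
`(ω_a, σ) ↦ (ω_a + Υ_a σ, σ)`:
`(τ, v_a, w_{ab}) ↦ (τ, v_a + Υ_a τ, w_{ab} + 2 Υ_{(a} v_{b)} + Υ_a Υ_b τ)`. -/
def change (Υ : VF n M →ₗ[Fn n M] Fn n M) (s : Slots n M) : Slots n M where
  top := s.top
  mid := s.mid + Υ.smulRight s.top
  bot := s.bot + (cst 2 : Fn n M) • sym2 (Υ.smulRight s.mid)
    + sym2 (Υ.smulRight (Υ.smulRight s.top))

lemma change_top (Υ : VF n M →ₗ[Fn n M] Fn n M) (s : Slots n M) :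
    (change Υ s).top = s.top := rfl

lemma change_mid (Υ : VF n M →ₗ[Fn n M] Fn n M) (s : Slots n M) (X : VF n M) :
    (change Υ s).mid X = s.mid X + Υ X • s.top := rfl

lemma change_bot (Υ : VF n M →ₗ[Fn n M] Fn n M) (s : Slots n M) (X Y : VF n M) :
    (change Υ s).bot.1 X Y =
      s.bot.1 X Y + Υ X • s.mid Y + Υ Y • s.mid X + (Υ X * Υ Y) • s.top := by
  have h1 : (cst 2 : Fn n M) * cst (1 / 2) = 1 := by
    rw [← map_mul]; norm_num
  have h2 : (cst (1 / 2) : Fn n M) * 2 = 1 := by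
    rw [← map_ofNat (algebraMap ℝ (Fn n M)) 2, ← map_mul]; norm_num
  change s.bot.1 X Y + (cst 2 : Fn n M) • ((cst (1 / 2) : Fn n M) • (Υ X • s.mid Y + Υ Y • s.mid X))
    + (cst (1 / 2) : Fn n M) • (Υ X • Υ Y • s.top + Υ Y • Υ X • s.top) = _
  rw [smul_smul, h1, one_smul]
  have : (cst (1 / 2) : Fn n M) • (Υ X • Υ Y • s.top + Υ Y • Υ X • s.top) =
      ((cst (1 / 2) : Fn n M) * 2) • (Υ X * Υ Y) • s.top := by module
  rw [this, h2, one_smul]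
  abel

lemma change_add (Υ : VF n M →ₗ[Fn n M] Fn n M) (s t : Slots n M) :
    change Υ (s + t) = change Υ s + change Υ t := by
  refine ext rfl (fun X => ?_) (fun X Y => ?_)
  · change _ = (change Υ s).mid X + (change Υ t).mid X
    rw [change_mid, change_mid, change_mid]
    change s.mid X + t.mid X + Υ X • (s.top + t.top) = _
    module
  · change _ = (change Υ s).bot.1 X Y + (change Υ t).bot.1 X Y
    rw [change_bot, change_bot, change_bot]
    change s.bot.1 X Y + t.bot.1 X Y + Υ X • (s.mid Y + t.mid Y) + Υ Y • (s.mid X + t.mid X)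
      + (Υ X * Υ Y) • (s.top + t.top) = _
    module

lemma change_smul (Υ : VF n M →ₗ[Fn n M] Fn n M) (f : Fn n M) (s : Slots n M) :
    change Υ (f • s) = f • change Υ s := by
  refine ext rfl (fun X => ?_) (fun X Y => ?_)
  · change _ = f • (change Υ s).mid X
    rw [change_mid, change_mid]
    change f • s.mid X + Υ X • (f • s.top) = _
    module
  · change _ = f • (change Υ s).bot.1 X Y
    rw [change_bot, change_bot]
    change f • s.bot.1 X Y + Υ X • (f • s.mid Y) + Υ Y • (f • s.mid X)
      + (Υ X * Υ Y) • (f • s.top) = _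
    module

lemma change_comp (Υ Υ' : VF n M →ₗ[Fn n M] Fn n M) (s : Slots n M) :
    change Υ (change Υ' s) = change (Υ' + Υ) s := by
  refine ext rfl (fun X => ?_) (fun X Y => ?_)
  · simp only [change_mid, change_top, LinearMap.add_apply]
    module
  · simp only [change_bot, change_mid, change_top, LinearMap.add_apply]
    module

lemma change_zero (s : Slots n M) : change 0 s = s := by
  refine ext rfl (fun X => ?_) (fun X Y => ?_)
  · simp only [change_mid, LinearMap.zero_apply, zero_smul, add_zero]
  · simp only [change_bot, LinearMap.zero_apply, zero_smul, add_zero, zero_mul]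

end Slots

/-- The sections of the symmetric square `T_(AB)` of the cotractor bundle of a projective structure:
a triple of slots for each connection of the projective class, subject to the
transformation law of the slots. -/
@[ext]
structure SymTractor (p : ProjectiveStructure n M) where
  /-- the slots in a connection of the projective class -/
  slots : {D : AffineConnection n M // ⟦D⟧ = p} → Slots n M
  transform : ∀ (D D' : {D : AffineConnection n M // ⟦D⟧ = p}) Υ,
    IsProjectiveChange Υ D.1 D'.1 → slots D' = Slots.change Υ (slots D)

namespace SymTractor
variable {p : ProjectiveStructure n M}

instance : Add (SymTractor p) :=
  ⟨fun s t => ⟨fun D => s.slots D + t.slots D, fun D D' Υ h => by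
    rw [s.transform D D' Υ h, t.transform D D' Υ h, Slots.change_add]⟩⟩

instance : SMul (Fn n M) (SymTractor p) :=
  ⟨fun f s => ⟨fun D => f • s.slots D, fun D D' Υ h => by
    rw [s.transform D D' Υ h, Slots.change_smul]⟩⟩

instance : Zero (SymTractor p) :=
  ⟨⟨fun _ => 0, fun _ _ Υ _ => by
    have h0 := Slots.change_smul Υ 0 0
    rw [zero_smul, zero_smul] at h0
    exact h0.symm⟩⟩

instance : Neg (SymTractor p) :=
  ⟨fun s => ⟨fun D => -s.slots D, fun D D' Υ h => by
    rw [s.transform D D' Υ h, ← neg_one_smul (Fn n M) (s.slots D), Slots.change_smul,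
      neg_one_smul]⟩⟩

instance : AddCommGroup (SymTractor p) :=
  { AddGroup.ofLeftAxioms (G := SymTractor p)
      (fun a b c => SymTractor.ext (funext fun _ => add_assoc _ _ _))
      (fun a => SymTractor.ext (funext fun _ => zero_add _))
      (fun a => SymTractor.ext (funext fun _ => neg_add_cancel _)) with
    add_comm := fun a b => SymTractor.ext (funext fun _ => add_comm _ _) }

instance : Module (Fn n M) (SymTractor p) where
  one_smul s := SymTractor.ext (funext fun _ => one_smul _ _)
  mul_smul f g s := SymTractor.ext (funext fun _ => mul_smul _ _ _)
  smul_zero f := SymTractor.ext (funext fun _ => smul_zero _)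
  smul_add f s t := SymTractor.ext (funext fun _ => smul_add _ _ _)
  add_smul f g s := SymTractor.ext (funext fun _ => add_smul _ _ _)
  zero_smul s := SymTractor.ext (funext fun _ => zero_smul _ _)

end SymTractor

lemma projectiveChange_unique [T2Space M] {Υ Υ' : VF n M →ₗ[Fn n M] Fn n M}
    {D D' : AffineConnection n M} (h : IsProjectiveChange Υ D D')
    (h' : IsProjectiveChange Υ' D D') : Υ = Υ' := by
  ext1 X
  ext x
  by_cases hX : X x = 0
  · rw [form_apply_eq_zero Υ hX, form_apply_eq_zero Υ' hX]
  · have h1 := (h X X).symm.trans (h' X X)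
    have h2 := congrArg (fun Y : VF n M => Y x) h1
    simp only [ContMDiffSection.coe_add, Pi.add_apply, vf_smul_apply] at h2
    have h3 : (2 * (Υ X x - Υ' X x)) • X x = 0 := by
      have : (2 * (Υ X x - Υ' X x)) • X x = (D.nabla X X x + Υ X x • X x + Υ X x • X x) -
        (D.nabla X X x + Υ' X x • X x + Υ' X x • X x) := by module
      rw [this, h2, sub_self]
    rcases smul_eq_zero.1 h3 with h4 | h4
    · linarith
    · exact absurd h4 hX

/-- A connection of the projective class identifies the sections of `T_(AB)` with triples of
slots. -/
def splitting [T2Space M] (D : AffineConnection n M) (p : ProjectiveStructure n M)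
    (hD : ⟦D⟧ = p) : SymTractor p ≃ₗ[Fn n M] Slots n M :=
  LinearEquiv.ofBijective
    ({ toFun := fun s => s.slots ⟨D, hD⟩
       map_add' := fun _ _ => rfl
       map_smul' := fun _ _ => rfl } : SymTractor p →ₗ[Fn n M] Slots n M) <| by
    have hex : ∀ D' : {D : AffineConnection n M // ⟦D⟧ = p}, ∃ Υ, IsProjectiveChange Υ D D'.1 :=
      fun D' => Quotient.exact (hD.trans D'.2.symm)
    constructor
    · intro s t h
      refine SymTractor.ext (funext fun D' => ?_)
      obtain ⟨Υ, hΥ⟩ := hex D'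
      rw [s.transform ⟨D, hD⟩ D' Υ hΥ, t.transform ⟨D, hD⟩ D' Υ hΥ]
      exact congrArg _ h
    · intro u
      choose Υ hΥ using hex
      refine ⟨⟨fun D' => Slots.change (Υ D') u, ?_⟩, ?_⟩
      · intro D₁ D₂ Θ hΘ
        have : Υ D₂ = Υ D₁ + Θ := projectiveChange_unique (hΥ D₂) (fun X Y => by
          rw [hΘ X Y, hΥ D₁ X Y]; simp only [LinearMap.add_apply]; module)
        change Slots.change (Υ D₂) u = Slots.change Θ (Slots.change (Υ D₁) u)
        rw [Slots.change_comp, this]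
      · have h0 : Υ ⟨D, hD⟩ = 0 := projectiveChange_unique (hΥ ⟨D, hD⟩) (fun X Y => by simp)
        change Slots.change (Υ ⟨D, hD⟩) u = u
        rw [h0, Slots.change_zero]

section Einstein
variable [T2Space M]

/-- An Einstein scale of a projective structure: an Einstein metric, together with its Levi-Civita
connection, which belongs to the projective class. -/
structure EinsteinScale (p : ProjectiveStructure n M) where
  /-- the Einstein metric -/
  metric : PseudoRiemannianMetric n M
  /-- its Levi-Civita connection -/
  conn : AffineConnection n M
  conn_mem : ⟦conn⟧ = p
  metric_compatible : ∀ X Y Z, dir X (metric.form Y Z) =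
    metric.form (conn.nabla X Y) Z + metric.form Y (conn.nabla X Z)
  einstein : ∃ Λ : ℝ, conn.ricci = (cst Λ : Fn n M) • metric.form

namespace EinsteinScale
variable {p : ProjectiveStructure n M} (S : EinsteinScale p)

/-- The projective Schouten tensor `Q_{ab}` in the Einstein scale. -/
def schouten : VF n M →ₗ[Fn n M] VF n M →ₗ[Fn n M] Fn n M := S.conn.schouten

/-- The tensor `W_{abc}{}^d`, obtained from the projective Weyl tensor `W_{ab}{}^d{}_c` by lowering
and raising indices with the Einstein metric: `g(T(X,Y,Z), Z') = g(W(X,Y)Z', Z)`. -/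
def weylLow : VF n M →ₗ[Fn n M] VF n M →ₗ[Fn n M] VF n M →ₗ[Fn n M] VF n M :=
  mkTrilin (fun X Y Z => S.metric.sharp ((S.metric.form.flip Z) ∘ₗ (S.conn.weyl X Y)))
    (fun X X' Y Z => by
      rw [map_add, LinearMap.add_apply, LinearMap.comp_add, map_add])
    (fun f X Y Z => by
      rw [map_smul, LinearMap.smul_apply, LinearMap.comp_smul, map_smul])
    (fun X Y Y' Z => by
      rw [map_add, LinearMap.comp_add, map_add])
    (fun f X Y Z => by
      rw [map_smul, LinearMap.comp_smul, map_smul])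
    (fun X Y Z Z' => by
      rw [map_add, LinearMap.add_comp, map_add])
    (fun f X Y Z => by
      rw [map_smul, LinearMap.smul_comp, map_smul])

/-- The connection on densities of weight `w` which preserves the powers of the volume density of
the Einstein metric. -/
def densityConn (w : ℝ) : LinearConnection n M (Density n M w) :=
  (LinearConnection.ofFn n M).transport (S.metric.triv w)

/-- The second covariant derivative `∇_a ∇_b σ`. -/
def hess {w : ℝ} (σ : Density n M w) : VF n M →ₗ[Fn n M] VF n M →ₗ[Fn n M] Density n M w :=
  ((S.densityConn w).hom S.conn).d ((S.densityConn w).d σ)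

/-- The third covariant derivative `∇_a ∇_b ∇_c σ`. -/
def thirdDeriv {w : ℝ} (σ : Density n M w) :
    VF n M →ₗ[Fn n M] VF n M →ₗ[Fn n M] VF n M →ₗ[Fn n M] Density n M w :=
  (((S.densityConn w).hom S.conn).hom S.conn).d (S.hess σ)

/-- The covariant derivative `∇_a Q_{bc}`. -/
def nablaSchouten : VF n M →ₗ[Fn n M] VF n M →ₗ[Fn n M] VF n M →ₗ[Fn n M] Fn n M :=
  (((LinearConnection.ofFn n M).hom S.conn).hom S.conn).d S.schouten

/-- The covariant derivative `∇_e W_{abc}{}^d`; the first argument is `e`. -/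
def nablaWeyl : VF n M →ₗ[Fn n M] VF n M →ₗ[Fn n M] VF n M →ₗ[Fn n M] VF n M →ₗ[Fn n M] VF n M :=
  ((((LinearConnection.ofAffine S.conn).hom S.conn).hom S.conn).hom S.conn).d S.weylLow

/-- The third-order first BGG operator `E(2) → ⊙³T*M(2)`,
`σ ↦ ½ (∇_{(a}∇_b∇_{c)} σ + 4 Q_{(ab}∇_{c)} σ + 2 (∇_{(a}Q_{bc)}) σ)`. -/
def bgg (σ : Density n M 2) : SymForm3 n M (Density n M 2) :=
  (cst (1 / 2) : Fn n M) • (sym3 (S.thirdDeriv σ)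
    + (cst 4 : Fn n M) • sym3 (S.schouten.compr₂
        (LinearMap.toSpanSingleton (Fn n M) _ ((S.densityConn 2).d σ)))
    + (cst 2 : Fn n M) • sym3 (S.nablaSchouten.compr₂
        ((LinearMap.toSpanSingleton (Fn n M) _ σ).compRight (Fn n M))))

lemma schouten_symm (X Y : VF n M) : S.schouten X Y = S.schouten Y X := by
  obtain ⟨Λ, h⟩ := S.einstein
  have hg : S.metric.form X Y = S.metric.form Y X := by
    ext x; exact S.metric.symm x _ _
  simp [schouten, AffineConnection.schouten, h, hg]

lemma hess_symm {w : ℝ} (σ : Density n M w) (X Y : VF n M) : S.hess σ X Y = S.hess σ Y X := by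
  obtain ⟨f, rfl⟩ := (S.metric.triv w).surjective σ
  have h : ∀ X Y, S.hess (S.metric.triv w f) X Y =
      S.metric.triv w (dir X (dir Y f) - dir (S.conn.nabla X Y) f) := by
    intro X Y
    simp [hess, LinearConnection.hom_apply, densityConn, LinearConnection.transport,
      LinearConnection.ofFn]
  have hb : dir (S.conn.nabla X Y) f - dir (S.conn.nabla Y X) f =
      dir X (dir Y f) - dir Y (dir X f) := by
    rw [← dir_bracket, ← S.conn.nabla_sub_nabla]
    exact (map_sub ((LinearConnection.ofFn n M).d f) _ _).symm
  rw [h, h]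
  congr 1
  linear_combination -hb

/-- The identification of the sections of `T_(AB)` with triples of slots in the Einstein scale. -/
def split : SymTractor p ≃ₗ[Fn n M] Slots n M := splitting S.conn p S.conn_mem

lemma add_smulRight {V : Type*} [AddCommGroup V] [Module (Fn n M) V]
    (α β : VF n M →ₗ[Fn n M] Fn n M) (v : V) :
    (α + β).smulRight v = α.smulRight v + β.smulRight v := by
  refine LinearMap.ext fun X => ?_
  exact add_smul (α X) (β X) v

lemma smul_smulRight {V : Type*} [AddCommGroup V] [Module (Fn n M) V]
    (f : Fn n M) (α : VF n M →ₗ[Fn n M] Fn n M) (v : V) :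
    (f • α).smulRight v = f • α.smulRight v := by
  refine LinearMap.ext fun X => ?_
  exact mul_smul f (α X) v

lemma smulRight_add' {V : Type*} [AddCommGroup V] [Module (Fn n M) V]
    (α : VF n M →ₗ[Fn n M] Fn n M) (v w : V) :
    α.smulRight (v + w) = α.smulRight v + α.smulRight w := by
  refine LinearMap.ext fun X => ?_
  exact smul_add (α X) v w

lemma smulRight_smul' {V : Type*} [AddCommGroup V] [Module (Fn n M) V]
    (f : Fn n M) (α : VF n M →ₗ[Fn n M] Fn n M) (v : V) :
    α.smulRight (f • v) = f • α.smulRight v := by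
  refine LinearMap.ext fun X => ?_
  exact smul_comm (α X) f v

/-- The tractor connection on the slots of `T_(AB)`:
`∇_c (τ, v_a, w_{ab}) = (∇_c τ - 2 v_c, ∇_c v_a + Q_{ca} τ - w_{ca}, ∇_c w_{ab} + 2 Q_{c(a} v_{b)})`. -/
def slotConn : LinearConnection n M (Slots n M) where
  d s :=
    { toFun := fun X =>
        { top := (S.densityConn 2).d s.top X - (cst 2 : Fn n M) • s.mid X
          mid := ((S.densityConn 2).hom S.conn).d s.mid X + (S.schouten X).smulRight s.top
            - s.bot.1 X
          bot := ((S.densityConn 2).symForm2 S.conn).d s.bot X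
            + (cst 2 : Fn n M) • sym2 ((S.schouten X).smulRight s.mid) }
      map_add' := fun X Y => by
        refine Slots.ext' ?_ ?_ ?_
        · simp only [Slots.add_top, map_add]; module
        · simp only [Slots.add_mid, map_add, add_smulRight]; module
        · simp only [Slots.add_bot, map_add, add_smulRight]; module
      map_smul' := fun f X => by
        refine Slots.ext' ?_ ?_ ?_
        · simp only [Slots.smul_top, map_smul, RingHom.id_apply]; module
        · simp only [Slots.smul_mid, map_smul, smul_smulRight, RingHom.id_apply]; module
        · simp only [Slots.smul_bot, map_smul, smul_smulRight, RingHom.id_apply]; module }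
  d_add s t := by
    refine LinearMap.ext fun X => ?_
    simp only [LinearMap.add_apply, LinearMap.coe_mk, AddHom.coe_mk]
    refine Slots.ext' ?_ ?_ ?_
    · simp only [Slots.add_top, Slots.add_mid, LinearConnection.d_add, LinearMap.add_apply]
      module
    · simp only [Slots.add_top, Slots.add_mid, Slots.add_bot, LinearConnection.d_add,
        LinearMap.add_apply, Submodule.coe_add, smulRight_add']
      module
    · simp only [Slots.add_mid, Slots.add_bot, LinearConnection.d_add, LinearMap.add_apply,
        smulRight_add', map_add]
      module
  d_smul f s X := by
    simp only [LinearMap.coe_mk, AddHom.coe_mk]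
    refine Slots.ext' ?_ ?_ ?_
    · simp only [Slots.add_top, Slots.smul_top, Slots.smul_mid, LinearConnection.d_smul,
        LinearMap.smul_apply]
      module
    · simp only [Slots.add_mid, Slots.smul_top, Slots.smul_mid, Slots.smul_bot,
        LinearConnection.d_smul, LinearMap.smul_apply, Submodule.coe_smul, smulRight_smul']
      module
    · simp only [Slots.add_bot, Slots.smul_mid, Slots.smul_bot, LinearConnection.d_smul,
        smulRight_smul', map_smul]
      module

/-- The term `-(2/3) W_{a(bc)}{}^d v_d` in the bottom slot, as a one-form with values in the
endomorphisms. -/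
def prolongationTerm : Slots n M →ₗ[Fn n M] VF n M →ₗ[Fn n M] Slots n M :=
  LinearMap.mk₂ (Fn n M)
    (fun s X => Slots.insertBot n M
      ((cst (-(2 / 3)) : Fn n M) • sym2 ((S.weylLow X).compr₂ s.mid)))
    (fun s t X => by
      refine Slots.ext (add_zero _).symm (fun _ => (add_zero _).symm) (fun Z U => ?_)
      change (cst _ : Fn n M) • ((cst _ : Fn n M) • ((s.mid _ + t.mid _) + (s.mid _ + t.mid _))) =
        (cst _ : Fn n M) • ((cst _ : Fn n M) • (s.mid _ + s.mid _)) +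
        (cst _ : Fn n M) • ((cst _ : Fn n M) • (t.mid _ + t.mid _))
      module)
    (fun f s X => by
      refine Slots.ext (smul_zero f).symm (fun _ => (smul_zero f).symm) (fun Z U => ?_)
      change (cst _ : Fn n M) • ((cst _ : Fn n M) • (f • s.mid _ + f • s.mid _)) =
        f • (cst _ : Fn n M) • ((cst _ : Fn n M) • (s.mid _ + s.mid _))
      module)
    (fun s X Y => by
      refine Slots.ext (add_zero _).symm (fun _ => (add_zero _).symm) (fun Z U => ?_)
      change (cst _ : Fn n M) • ((cst _ : Fn n M) •
          (s.mid (S.weylLow (X + Y) Z U) + s.mid (S.weylLow (X + Y) U Z))) =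
        (cst _ : Fn n M) • ((cst _ : Fn n M) •
          (s.mid (S.weylLow X Z U) + s.mid (S.weylLow X U Z))) +
        (cst _ : Fn n M) • ((cst _ : Fn n M) •
          (s.mid (S.weylLow Y Z U) + s.mid (S.weylLow Y U Z)))
      simp only [map_add, LinearMap.add_apply]
      module)
    (fun f s X => by
      refine Slots.ext (smul_zero f).symm (fun _ => (smul_zero f).symm) (fun Z U => ?_)
      change (cst _ : Fn n M) • ((cst _ : Fn n M) •
          (s.mid (S.weylLow (f • X) Z U) + s.mid (S.weylLow (f • X) U Z))) =
        f • (cst _ : Fn n M) • ((cst _ : Fn n M) •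
          (s.mid (S.weylLow X Z U) + s.mid (S.weylLow X U Z)))
      simp only [map_smul, LinearMap.smul_apply]
      module)

/-- The prolongation connection on the slots of `T_(AB)`. -/
def slotProlongation : LinearConnection n M (Slots n M) :=
  S.slotConn.addTerm S.prolongationTerm

/-- The tractor connection on `T_(AB)`. -/
def tractorConn : LinearConnection n M (SymTractor p) := S.slotConn.transport S.split.symm

/-- The prolongation connection on `T_(AB)`. -/
def prolongationConn : LinearConnection n M (SymTractor p) :=
  S.slotProlongation.transport S.split.symm

/-- The splitting operator `L₀ : E(2) → T_(AB)`, `σ ↦ (σ, ½ ∇_a σ, (½ ∇_a ∇_b + Q_{ab}) σ)`. -/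
def splitOp₀ (σ : Density n M 2) : SymTractor p :=
  S.split.symm
    { top := σ
      mid := (cst (1 / 2) : Fn n M) • (S.densityConn 2).d σ
      bot := ⟨(cst (1 / 2) : Fn n M) • S.hess σ +
        S.schouten.compr₂ (LinearMap.toSpanSingleton (Fn n M) _ σ), fun X Y => by
          change (cst (1 / 2) : Fn n M) • S.hess σ X Y + S.schouten X Y • σ =
            (cst (1 / 2) : Fn n M) • S.hess σ Y X + S.schouten Y X • σ
          rw [S.hess_symm, S.schouten_symm]⟩ }

/-- The splitting operator `L₁ : ⊙³T*M(2) → Λ¹(T_(AB))`, `ψ ↦ (0, 0, ψ_{cab})`, where `c` is the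
form index. -/
def splitOp₁ (ψ : SymForm3 n M (Density n M 2)) : VF n M →ₗ[Fn n M] SymTractor p :=
  S.split.symm.toLinearMap ∘ₗ Slots.insertBot n M ∘ₗ
    LinearMap.codRestrict (SymForm2 n M (Density n M 2)) ψ.1 (fun X Y Z => (ψ.2 X Y Z).2)

/-- The bottom slot of the curvature of the prolongation connection, evaluated on vector fields `X`
and `Y` and applied to `(τ, v_a, w_{ab})`:
`-(2/3) (d^∇ W)_{(ab)}{}^c v_c + 2 W_{(a}{}^c w_{b)c} + (2/3) W_{(ab)}{}^c ∧ w_c`, where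
`W_{ab}{}^c` and `w_c` denote the one-forms `W_{eab}{}^c` and `w_{ec}`, and `W_a{}^c` the two-form
`W_{efa}{}^c`. -/
def curvatureSlot (X Y : VF n M) (s : Slots n M) : SymForm2 n M (Density n M 2) :=
  (cst (-(2 / 3)) : Fn n M) • sym2 ((S.nablaWeyl X Y - S.nablaWeyl Y X).compr₂ s.mid)
    + (cst 2 : Fn n M) • sym2 (s.bot.1.flip ∘ₗ S.weylLow X Y)
    + (cst (2 / 3) : Fn n M) •
      sym2 ((S.weylLow X).compr₂ (s.bot.1 Y) - (S.weylLow Y).compr₂ (s.bot.1 X))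

end EinsteinScale
end Einstein
end
end ProjTractor

open ProjTractor

namespace ProjTractor
noncomputable section
open Bundle Module

variable {n : ℕ} {M : Type*} [TopologicalSpace M] [ChartedSpace (EuclideanSpace ℝ (Fin n)) M]
  [IsManifold (𝓡 n) ∞ M]

/-! In the Einstein scale everything reduces to tensor calculus with three simplifications. The
Schouten tensor `Q` is a constant multiple of the metric (`exists_schouten_eq`), so it is symmetric
and parallel. The powers of the volume density are parallel, so densities carry a flat connection
(`densityConn_flat`) and only vector arguments see curvature. Finally `Q`-terms of the form `δ_a^d
Q_{bc} - δ_b^d Q_{ac}` have all the symmetries of a Riemann tensor, hence so does the Weyl tensor.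
Write `T(X,Y,Z)` for `weylLow`: skewness of the lowered Weyl tensor in its last pair gives `T(X,Y,Z)
= -W(X,Y)Z` (`weylLow_eq`), so `R(X,Y)Z = Q(Y,Z)X - Q(X,Z)Y - T(X,Y,Z)`. This, the Bianchi identity
for `T` and the pair symmetry `schouten_weylLow_pair` are the only geometric inputs.

For the first claim, the slots of `L₀σ` are those that make the top and middle slots of the
derivative vanish. The bottom slot is `½∇_c∇_a∇_bσ` plus terms in `Q` and `T`. Two Ricci identities
compare `∇_c∇_a∇_bσ` with its cyclic permutations: a third of the sum of both commutators is the
deviation from the symmetrization. Its `T`-part cancels the prolongation term, and its `Q`-part,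
added to the `Q`-terms of the tractor connection, gives the coefficient 4 in `D` (`splitSlots_bot`).

For the second claim the curvature is computed slot by slot. In the top slot only symmetric
quantities are skewed. In the middle slot the tractor curvature contributes `v(T(X,Y,Z))`, and by
Bianchi the prolongation term contributes its negative; this is what the factor `-2/3` achieves. In
the bottom slot the multiples of `τ` cancel because `QQ` is symmetrized and by pair symmetry of `T`.
What survives is the curvature acting on `w`, the exterior derivative of the prolongation term
acting on `v`, and the prolongation term contracted with the `-w` of the middle slot. -/

/-! ### Constants and formal properties of linear connections. -/

lemma dir_cst (X : VF n M) (r : ℝ) : dir X (cst r : Fn n M) = 0 := by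
  ext x
  have : ((cst r : Fn n M) : M → ℝ) = fun _ => r := rfl
  rw [dir_apply, this, mvfderiv_const]
  rfl

lemma cst_ofNat (k : ℕ) [k.AtLeastTwo] : (cst (OfNat.ofNat k) : Fn n M) = OfNat.ofNat k :=
  map_ofNat _ k

/-- The scalars form the ring `Fn n M`, where rational coefficients occur as constant functions that
`module` treats as atoms; relations such as this one are supplied by hand. -/
lemma three_mul_cst_third : (3 : Fn n M) * cst (1 / 3) = 1 := by
  rw [← cst_ofNat, ← map_mul]; norm_num

lemma two_mul_cst_half : (2 : Fn n M) * cst (1 / 2) = 1 := by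
  rw [← cst_ofNat, ← map_mul]; norm_num

namespace LinearConnection
variable {V W : Type*} [AddCommGroup V] [Module (Fn n M) V] [AddCommGroup W] [Module (Fn n M) W]

lemma d_zero (C : LinearConnection n M V) : C.d 0 = 0 := by
  have h := C.d_add 0 0
  rwa [add_zero, left_eq_add] at h

lemma d_neg (C : LinearConnection n M V) (s : V) : C.d (-s) = -C.d s := by
  have h := C.d_add s (-s)
  rw [add_neg_cancel, d_zero] at h
  exact (neg_eq_of_add_eq_zero_right h.symm).symm

lemma d_sub (C : LinearConnection n M V) (s t : V) : C.d (s - t) = C.d s - C.d t := by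
  rw [sub_eq_add_neg, C.d_add, C.d_neg, sub_eq_add_neg]

lemma d_cst_smul (C : LinearConnection n M V) (r : ℝ) (s : V) :
    C.d ((cst r : Fn n M) • s) = (cst r : Fn n M) • C.d s := by
  ext X
  rw [C.d_smul, dir_cst, zero_smul, add_zero, LinearMap.smul_apply]

/-- Allows the curvature on `T_(AB)` and on densities to be computed in a trivialisation. -/
lemma curv_transport (C : LinearConnection n M V) (e : V ≃ₗ[Fn n M] W) (X Y : VF n M) (s : W) :
    (C.transport e).curv X Y s = e (C.curv X Y (e.symm s)) := by
  simp [curv, transport]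

end LinearConnection

/-! ### The Jacobi identity and the curvature of a torsion-free connection. -/

lemma bracket_jacobi (X Y Z : VF n M) :
    bracket X (bracket Y Z) + bracket Y (bracket Z X) + bracket Z (bracket X Y) = 0 := by
  have e : bracket X (bracket Y Z) = bracket (bracket X Y) Z + bracket Y (bracket X Z) := by
    ext x
    have : IsManifold (𝓡 n) (minSmoothness ℝ 3) M := by
      rw [minSmoothness_of_isRCLikeNormedField]
      exact IsManifold.of_le (n := ∞) (ENat.LEInfty.out)
    have h (V : VF n M) : ContMDiffAt (𝓡 n) (𝓡 n).tangent (minSmoothness ℝ 2)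
        (fun y => (⟨y, V y⟩ : TangentBundle (𝓡 n) M)) x := by
      rw [minSmoothness_of_isRCLikeNormedField]
      exact (V.contMDiff x).of_le ENat.LEInfty.out
    exact VectorField.leibniz_identity_mlieBracket_apply (h X) (h Y) (h Z)
  -- The sign is moved to the first argument by antisymmetry; there `-1` acts as a constant
  -- function, whose derivative vanishes.
  have hn : bracket Y (-bracket Z X) = -bracket Y (bracket Z X) := by
    have := bracket_smul_left (-1) (bracket Z X) Y
    rw [bracket_swap Y, bracket_swap Y (bracket Z X), neg_inj]
    rw [show (-1 : Fn n M) = cst (-1) by simp, dir_cst] at this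
    simpa using this
  rw [e, bracket_swap X Z, hn, bracket_swap (bracket X Y)]
  abel

namespace AffineConnection
variable (D : AffineConnection n M)

lemma nabla_sub_right (X Y Y' : VF n M) : D.nabla X (Y - Y') = D.nabla X Y - D.nabla X Y' :=
  DFunLike.congr_fun ((LinearConnection.ofAffine D).d_sub Y Y') X

lemma nabla_sub_left (X X' Y : VF n M) : D.nabla (X - X') Y = D.nabla X Y - D.nabla X' Y :=
  map_sub ((LinearConnection.ofAffine D).d Y) X X'

/-- Torsion-freeness eliminates the Lie bracket, so that later identities involve only iterated
covariant derivatives. -/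
lemma curvature_eq (X Y Z : VF n M) : D.curvature X Y Z =
    D.nabla X (D.nabla Y Z) - D.nabla Y (D.nabla X Z)
      - (D.nabla (D.nabla X Y) Z - D.nabla (D.nabla Y X) Z) := by
  rw [curvature_apply, ← nabla_sub_nabla, nabla_sub_left]

lemma curvature_swap (X Y Z : VF n M) : D.curvature X Y Z = -D.curvature Y X Z := by
  rw [curvature_eq, curvature_eq]; abel

/-- The first Bianchi identity is the Jacobi identity with both brackets expressed through the
torsion-free connection. -/
lemma curvature_bianchi (X Y Z : VF n M) :
    D.curvature X Y Z + D.curvature Y Z X + D.curvature Z X Y = 0 := by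
  have hb (X Y Z : VF n M) : bracket X (bracket Y Z) =
      D.nabla X (D.nabla Y Z) - D.nabla X (D.nabla Z Y) - D.nabla (bracket Y Z) X := by
    rw [← D.nabla_sub_nabla X (bracket Y Z), ← nabla_sub_right, D.nabla_sub_nabla Y Z]
  have h := bracket_jacobi X Y Z
  rw [hb, hb, hb] at h
  rw [← h]
  simp only [curvature_apply]
  abel

end AffineConnection

/-! ### Symmetries of the curvature, Schouten and Weyl tensors in the Einstein scale. -/

section
variable [T2Space M]

lemma PseudoRiemannianMetric.form_symm (g : PseudoRiemannianMetric n M) (X Y : VF n M) :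
    g.form X Y = g.form Y X := by
  ext x; exact g.symm x _ _

namespace EinsteinScale
variable {p : ProjectiveStructure n M} (S : EinsteinScale p)

/-- Commuting two derivatives of the function `g(Z,U)` and expanding by metric compatibility makes
the mixed terms cancel. -/
lemma form_curvature (X Y Z U : VF n M) : S.metric.form (S.conn.curvature X Y Z) U =
    -S.metric.form Z (S.conn.curvature X Y U) := by
  have h := dir_bracket X Y (S.metric.form Z U)
  simp only [S.metric_compatible, dir_add] at h
  simp only [S.conn.curvature_apply, map_sub, LinearMap.sub_apply]
  linear_combination -h

lemma form_curvature_pair (X Y Z U : VF n M) : S.metric.form (S.conn.curvature X Y Z) U =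
    S.metric.form (S.conn.curvature Z U X) Y := by
  have hs (X Y Z U) : S.metric.form (S.conn.curvature X Y Z) U =
      -S.metric.form (S.conn.curvature X Y U) Z := by
    rw [S.form_curvature, S.metric.form_symm]
  have ha (X Y Z U) : S.metric.form (S.conn.curvature X Y Z) U =
      -S.metric.form (S.conn.curvature Y X Z) U := by
    rw [S.conn.curvature_swap, map_neg, LinearMap.neg_apply]
  have hb (X Y Z U) : S.metric.form (S.conn.curvature X Y Z) U
      + S.metric.form (S.conn.curvature Y Z X) U + S.metric.form (S.conn.curvature Z X Y) U = 0 := by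
    have := DFunLike.congr_fun (congrArg S.metric.form (S.conn.curvature_bianchi X Y Z)) U
    simpa only [map_add, map_zero, LinearMap.add_apply, LinearMap.zero_apply] using this
  have h2 := two_mul_cst_half (n := n) (M := M)
  -- The classical octahedron argument: of the four Bianchi identities obtained by cycling `X, Y, Z,
  -- U`, a signed sum leaves only twice the desired equality. The `rw`s bring equal components to
  -- the same form.
  have key : (2 : Fn n M) * S.metric.form (S.conn.curvature X Y Z) U =
      2 * S.metric.form (S.conn.curvature Z U X) Y := by
    have e1 := hb X Y Z U
    have e2 := hb Y Z U X
    have e3 := hb Z U X Y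
    have e4 := hb U X Y Z
    rw [hs Y Z U X, hs Z U Y X, ha U Y Z X] at e2
    rw [ha U X Z Y, hs X U Z Y, ha X Z U Y, hs Z X U Y] at e3
    rw [ha U X Y Z, hs X Y U Z, hs Y U X Z] at e4
    linear_combination e1 + e2 - e3 - e4
  linear_combination cst (1 / 2) * key - (S.metric.form (S.conn.curvature X Y Z) U -
      S.metric.form (S.conn.curvature Z U X) Y) * h2

lemma exists_schouten_eq : ∃ r : ℝ, S.schouten = (cst r : Fn n M) • S.metric.form := by
  obtain ⟨Λ, h⟩ := S.einstein
  -- With `Ric = Λg` symmetric, `nR_{bc} + R_{cb}` is `(n + 1)Λ g_{bc}`.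
  refine ⟨1 / ((n : ℝ) ^ 2 - 1) * ((n + 1) * Λ), ?_⟩
  refine LinearMap.ext₂ fun X Y => ?_
  simp only [schouten, AffineConnection.schouten, h, LinearMap.smul_apply, LinearMap.add_apply,
    LinearMap.flip_apply, S.metric.form_symm Y X, map_mul, map_add, map_one]
  module

/-- This is `∇Q = 0` in product-rule form, ready for expanding derivatives of `Q`-terms. -/
lemma dir_schouten (X Y Z : VF n M) : dir X (S.schouten Y Z) =
    S.schouten (S.conn.nabla X Y) Z + S.schouten Y (S.conn.nabla X Z) := by
  obtain ⟨r, h⟩ := S.exists_schouten_eq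
  simp only [h, LinearMap.smul_apply, smul_eq_mul, dir_mul, dir_cst, S.metric_compatible]
  ring

lemma curvature_eq_weyl_add (X Y Z : VF n M) : S.conn.curvature X Y Z =
    S.conn.weyl X Y Z + S.schouten Y Z • X - S.schouten X Z • Y := by
  have h := S.schouten_symm X Y
  simp only [schouten] at h ⊢
  simp only [AffineConnection.weyl, mkTrilin_apply, h]
  module

/-- Lowering and raising exchanges the last two indices. Both `R` and the `Q`-part are skew in them,
the latter because `Q` is a multiple of `g`; hence so is `W`. -/
lemma weylLow_eq (X Y Z : VF n M) : S.weylLow X Y Z = -S.conn.weyl X Y Z := by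
  obtain ⟨r, h⟩ := S.exists_schouten_eq
  refine S.metric.form_bijective.1 (LinearMap.ext fun U => ?_)
  have h1 : S.metric.form (S.weylLow X Y Z) U = S.metric.form (S.conn.weyl X Y U) Z :=
    S.metric.form_sharp _ U
  have h2 := S.form_curvature X Y Z U
  rw [S.metric.form_symm Z] at h2
  simp only [curvature_eq_weyl_add, h, map_add, map_sub, map_smul, LinearMap.smul_apply,
    LinearMap.add_apply, LinearMap.sub_apply, smul_eq_mul] at h2
  rw [h1, map_neg, LinearMap.neg_apply]
  linear_combination h2

/-- The curvature in terms of `W_{abc}{}^d`. -/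
lemma curvature_eq_sub_weylLow (X Y Z : VF n M) : S.conn.curvature X Y Z =
    S.schouten Y Z • X - S.schouten X Z • Y - S.weylLow X Y Z := by
  rw [curvature_eq_weyl_add, S.weylLow_eq]; abel

lemma weylLow_eq_sub_curvature (X Y Z : VF n M) : S.weylLow X Y Z =
    S.schouten Y Z • X - S.schouten X Z • Y - S.conn.curvature X Y Z := by
  rw [S.curvature_eq_sub_weylLow]; abel

lemma weylLow_swap (X Y Z : VF n M) : S.weylLow X Y Z = -S.weylLow Y X Z := by
  rw [S.weylLow_eq_sub_curvature, S.weylLow_eq_sub_curvature, S.conn.curvature_swap X Y]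
  abel

/-- The cyclic sum of the `Q`-terms vanishes by symmetry of `Q`, leaving the Bianchi identity of
`R`. -/
lemma weylLow_bianchi (X Y Z : VF n M) :
    S.weylLow X Y Z + S.weylLow Y Z X + S.weylLow Z X Y = 0 := by
  have h := S.conn.curvature_bianchi X Y Z
  simp only [S.weylLow_eq_sub_curvature, S.schouten_symm Z X, S.schouten_symm Z Y,
    S.schouten_symm Y X]
  linear_combination (norm := module) -h

/-- Since `Q` is a multiple of `g`, this is pair symmetry combined with skewness in each pair. It
removes `τ` from the bottom slot of the curvature. -/
lemma schouten_weylLow_pair (X Y Z U : VF n M) :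
    S.schouten Y (S.weylLow X Z U) = S.schouten X (S.weylLow Y U Z) := by
  obtain ⟨r, h⟩ := S.exists_schouten_eq
  have h1 := S.form_curvature_pair X Z U Y
  have h2 := S.form_curvature U Y X Z
  have h3 := S.conn.curvature_swap U Y Z
  simp only [S.weylLow_eq_sub_curvature, h, map_sub, map_smul, LinearMap.smul_apply,
    smul_eq_mul]
  rw [h3, map_neg] at h2
  rw [S.metric.form_symm Y (S.conn.curvature X Z U), h1, h2, S.metric.form_symm Y X,
    S.metric.form_symm U Z]
  ring

end EinsteinScale
end

/-! ### Coefficients of symmetrized tensors. -/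

section
variable {V : Type*} [AddCommGroup V] [Module (Fn n M) V]

lemma cst_two_smul_sym2 (b : VF n M →ₗ[Fn n M] VF n M →ₗ[Fn n M] V) (X Y : VF n M) :
    (cst 2 : Fn n M) • (sym2 b).1 X Y = b X Y + b Y X := by
  rw [sym2_apply, smul_smul, ← map_mul]
  norm_num

lemma cst_two_thirds_smul_sym2 (b : VF n M →ₗ[Fn n M] VF n M →ₗ[Fn n M] V) (X Y : VF n M) :
    (cst (2 / 3) : Fn n M) • (sym2 b).1 X Y = (cst (1 / 3) : Fn n M) • (b X Y + b Y X) := by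
  rw [sym2_apply, smul_smul, ← map_mul]
  norm_num

lemma cst_neg_two_thirds_smul_sym2 (b : VF n M →ₗ[Fn n M] VF n M →ₗ[Fn n M] V) (X Y : VF n M) :
    (cst (-(2 / 3)) : Fn n M) • (sym2 b).1 X Y = -((cst (1 / 3) : Fn n M) • (b X Y + b Y X)) := by
  rw [show (cst (-(2 / 3)) : Fn n M) = -cst (2 / 3) from map_neg _ _, neg_smul, cst_two_thirds_smul_sym2]

/-- The symmetrisation of a trilinear form which is symmetric in its last two arguments. -/
lemma sym3_apply_of_symm (t : VF n M →ₗ[Fn n M] VF n M →ₗ[Fn n M] VF n M →ₗ[Fn n M] V)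
    (ht : ∀ X Y Z, t X Y Z = t X Z Y) (X Y Z : VF n M) :
    (sym3 t).1 X Y Z = (cst (1 / 3) : Fn n M) • (t X Y Z + t Y Z X + t Z X Y) := by
  have h : (cst (1 / 3) : Fn n M) = cst (1 / 6) + cst (1 / 6) := by
    rw [← map_add]; norm_num
  simp only [sym3, mkTrilin_apply]
  -- The six permutations coincide in pairs, leaving the three cyclic ones.
  rw [ht X Z Y, ht Z Y X, ht Y X Z, h]
  module
end

/-! ### Derivatives of densities, and the operators written out on vector fields. -/

section
variable [T2Space M]

namespace EinsteinScale
variable {p : ProjectiveStructure n M} (S : EinsteinScale p)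

/-- In the trivialisation by the metric volume the connection is the exterior derivative, whose
curvature vanishes by `dir_bracket`. The bracket is written as `∇_X Y - ∇_Y X` to match
`curvature_eq`. -/
lemma densityConn_flat {w : ℝ} (σ : Density n M w) (X Y : VF n M) :
    (S.densityConn w).d ((S.densityConn w).d σ Y) X - (S.densityConn w).d ((S.densityConn w).d σ X) Y
      = (S.densityConn w).d σ (S.conn.nabla X Y) - (S.densityConn w).d σ (S.conn.nabla Y X) := by
  have h : (S.densityConn w).curv X Y σ = 0 := by
    rw [densityConn, LinearConnection.curv_transport]
    have h0 (f : Fn n M) : (LinearConnection.ofFn n M).curv X Y f = 0 := by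
      change dir X (dir Y f) - dir Y (dir X f) - dir (bracket X Y) f = 0
      rw [dir_bracket, sub_self]
    rw [h0, map_zero]
  rw [← map_sub, S.conn.nabla_sub_nabla]
  exact sub_eq_zero.1 h

lemma hess_apply {w : ℝ} (σ : Density n M w) (X Y : VF n M) : S.hess σ X Y =
    (S.densityConn w).d ((S.densityConn w).d σ Y) X - (S.densityConn w).d σ (S.conn.nabla X Y) :=
  rfl

lemma thirdDeriv_apply {w : ℝ} (σ : Density n M w) (X Y Z : VF n M) : S.thirdDeriv σ X Y Z =
    (S.densityConn w).d (S.hess σ Y Z) X - S.hess σ (S.conn.nabla X Y) Z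
      - S.hess σ Y (S.conn.nabla X Z) := by
  simp only [thirdDeriv, LinearConnection.hom_apply, LinearMap.sub_apply]
  abel

lemma thirdDeriv_symm {w : ℝ} (σ : Density n M w) (X Y Z : VF n M) :
    S.thirdDeriv σ X Y Z = S.thirdDeriv σ X Z Y := by
  simp only [thirdDeriv_apply, S.hess_symm σ Z, S.hess_symm σ (S.conn.nabla X Z)]
  abel

/-- The Ricci identity `∇_a ∇_b ∇_c σ - ∇_b ∇_a ∇_c σ = - R_{ab}{}^d{}_c ∇_d σ`. -/
lemma thirdDeriv_sub_thirdDeriv {w : ℝ} (σ : Density n M w) (X Y Z : VF n M) :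
    S.thirdDeriv σ X Y Z - S.thirdDeriv σ Y X Z =
      -(S.densityConn w).d σ (S.conn.curvature X Y Z) := by
  -- Flatness is applied to the density `∇_Z σ`; the curvature arises only from differentiating the
  -- argument `Z`.
  have h := S.densityConn_flat ((S.densityConn w).d σ Z) X Y
  simp only [thirdDeriv_apply, hess_apply, S.conn.curvature_eq, LinearConnection.d_sub, map_sub,
    LinearMap.sub_apply]
  linear_combination (norm := module) h

lemma nablaSchouten_eq_zero : S.nablaSchouten = 0 := by
  refine LinearMap.ext fun X => LinearMap.ext₂ fun Y Z => ?_
  have h : S.nablaSchouten X Y Z = dir X (S.schouten Y Z) - S.schouten Y (S.conn.nabla X Z)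
      - S.schouten (S.conn.nabla X Y) Z := rfl
  rw [h, S.dir_schouten]
  simp

lemma nablaWeyl_apply (X Y Z U : VF n M) : S.nablaWeyl X Y Z U =
    S.conn.nabla X (S.weylLow Y Z U) - S.weylLow (S.conn.nabla X Y) Z U
      - S.weylLow Y (S.conn.nabla X Z) U - S.weylLow Y Z (S.conn.nabla X U) := by
  have h : S.nablaWeyl X Y Z U = S.conn.nabla X (S.weylLow Y Z U)
      - S.weylLow Y Z (S.conn.nabla X U) - S.weylLow Y (S.conn.nabla X Z) U
      - S.weylLow (S.conn.nabla X Y) Z U := rfl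
  rw [h]; abel

lemma slotProlongation_top (s : Slots n M) (X : VF n M) :
    (S.slotProlongation.d s X).top =
      (S.densityConn 2).d s.top X - s.mid X - s.mid X := by
  rw [sub_sub, ← two_smul (Fn n M), ← cst_ofNat]
  exact add_zero _

lemma slotProlongation_mid (s : Slots n M) (X Z : VF n M) :
    (S.slotProlongation.d s X).mid Z =
      (S.densityConn 2).d (s.mid Z) X - s.mid (S.conn.nabla X Z) + S.schouten X Z • s.top
        - s.bot.1 X Z :=
  add_zero _

lemma slotProlongation_bot (s : Slots n M) (X Z U : VF n M) :
    (S.slotProlongation.d s X).bot.1 Z U =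
      (S.densityConn 2).d (s.bot.1 Z U) X - s.bot.1 (S.conn.nabla X Z) U
        - s.bot.1 Z (S.conn.nabla X U) + S.schouten X Z • s.mid U + S.schouten X U • s.mid Z
        - (cst (1 / 3) : Fn n M) • (s.mid (S.weylLow X Z U) + s.mid (S.weylLow X U Z)) := by
  have h : (S.slotProlongation.d s X).bot.1 Z U =
      (S.densityConn 2).d (s.bot.1 Z U) X - s.bot.1 Z (S.conn.nabla X U)
        - s.bot.1 (S.conn.nabla X Z) U
      + (cst 2 : Fn n M) • (sym2 ((S.schouten X).smulRight s.mid)).1 Z U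
      + (cst (-(2 / 3)) : Fn n M) • (sym2 ((S.weylLow X).compr₂ s.mid)).1 Z U := rfl
  rw [h, cst_two_smul_sym2, cst_neg_two_thirds_smul_sym2]
  simp only [LinearMap.smulRight_apply, LinearMap.smul_apply, LinearMap.compr₂_apply]
  abel

/-- The term with `∇Q` drops out since `Q` is parallel, and symmetry of the Hessian and of `Q`
reduces each symmetrization to a cyclic sum. -/
lemma bgg_apply (σ : Density n M 2) (X Y Z : VF n M) : (S.bgg σ).1 X Y Z =
    (cst (1 / 2) : Fn n M) • (cst (1 / 3) : Fn n M) •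
      (S.thirdDeriv σ X Y Z + S.thirdDeriv σ Y Z X + S.thirdDeriv σ Z X Y
      + (4 : Fn n M) • (S.schouten X Y • (S.densityConn 2).d σ Z
        + S.schouten Y Z • (S.densityConn 2).d σ X + S.schouten Z X • (S.densityConn 2).d σ Y)) := by
  have h : (S.bgg σ).1 X Y Z = (cst (1 / 2) : Fn n M) • ((sym3 (S.thirdDeriv σ)).1 X Y Z
    + (cst 4 : Fn n M) • (sym3 (S.schouten.compr₂
        (LinearMap.toSpanSingleton (Fn n M) _ ((S.densityConn 2).d σ)))).1 X Y Z
    + (cst 2 : Fn n M) • (sym3 (S.nablaSchouten.compr₂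
        ((LinearMap.toSpanSingleton (Fn n M) _ σ).compRight (Fn n M)))).1 X Y Z) := rfl
  have h6 : (cst (1 / 3) : Fn n M) = cst (1 / 6) + cst (1 / 6) := by
    rw [← map_add]; norm_num
  rw [h, sym3_apply_of_symm _ (S.thirdDeriv_symm σ), nablaSchouten_eq_zero, cst_ofNat]
  simp only [sym3, mkTrilin_apply, LinearMap.compr₂_apply, LinearMap.toSpanSingleton_apply,
    LinearMap.zero_apply, LinearMap.smul_apply, map_zero, S.schouten_symm Z Y, S.schouten_symm X Z, S.schouten_symm Y X, h6]
  module

end EinsteinScale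

end

/-! ### The curvature of the prolongation connection, slot by slot. -/

namespace Slots

lemma sub_top (s t : Slots n M) : (s - t).top = s.top - t.top := by
  rw [sub_eq_add_neg, sub_eq_add_neg]; rfl

lemma sub_mid (s t : Slots n M) : (s - t).mid = s.mid - t.mid := by
  rw [sub_eq_add_neg, sub_eq_add_neg]; rfl

lemma sub_bot (s t : Slots n M) : (s - t).bot = s.bot - t.bot := by
  rw [sub_eq_add_neg, sub_eq_add_neg (a := s.bot)]; rfl

end Slots

section
variable [T2Space M]

namespace EinsteinScale
variable {p : ProjectiveStructure n M} (S : EinsteinScale p)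

lemma slotProlongation_curv_top (X Y : VF n M) (s : Slots n M) :
    (S.slotProlongation.curv X Y s).top = 0 := by
  have h := S.densityConn_flat s.top X Y
  simp only [LinearConnection.curv, Slots.sub_top, slotProlongation_top, slotProlongation_mid,
    LinearConnection.d_sub, LinearMap.sub_apply, ← S.conn.nabla_sub_nabla, map_sub,
    S.schouten_symm Y X, s.bot.2 Y X]
  linear_combination (norm := module) h

/-- The curvature acting on `v` leaves `v(T(X,Y,Z))` after its `Q`-part cancels. Skewing the
prolongation term gives a third of `v(-2T(X,Y,Z) + T(Y,Z,X) + T(Z,X,Y))`, which is `-v(T(X,Y,Z))` by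
Bianchi. -/
lemma slotProlongation_curv_mid (X Y Z : VF n M) (s : Slots n M) :
    (S.slotProlongation.curv X Y s).mid Z = 0 := by
  have h := S.densityConn_flat (s.mid Z) X Y
  have hR := congrArg s.mid (S.conn.curvature_eq X Y Z)
  have hB := congrArg s.mid (S.weylLow_bianchi X Y Z)
  have hs := congrArg s.mid (S.weylLow_swap X Z Y)
  have h3 := three_mul_cst_third (n := n) (M := M)
  rw [S.curvature_eq_sub_weylLow] at hR
  simp only [map_sub, map_add, map_smul, map_neg, map_zero] at hR hB hs
  simp only [LinearConnection.curv, Slots.sub_mid, slotProlongation_top, slotProlongation_mid,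
    slotProlongation_bot, LinearConnection.d_add, LinearConnection.d_smul, S.dir_schouten,
    LinearConnection.d_sub, LinearMap.sub_apply, LinearMap.add_apply, ← S.conn.nabla_sub_nabla,
    map_sub,
    S.schouten_symm Y X, S.weylLow_swap Y X, map_neg, hs]
  linear_combination (norm := skip) h + hR + (cst (1 / 3) : Fn n M) • hB - h3 • s.mid (S.weylLow X Y Z)
  module

set_option maxHeartbeats 2000000 in
-- Commuting derivatives on `w` inserts `R` into each argument: its `T`-part gives `2W_{(a}{}^c
-- w_{b)c}`, its `Q`-part cancels against the middle slot. Differentiating the prolongation term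
-- gives `d^∇W`, and evaluating it on the `-w` of the middle slot gives the wedge term.
lemma slotProlongation_curv_bot (X Y Z U : VF n M) (s : Slots n M) :
    (S.slotProlongation.curv X Y s).bot.1 Z U = (S.curvatureSlot X Y s).1 Z U := by
  have h := S.densityConn_flat (s.bot.1 Z U) X Y
  have hZ := DFunLike.congr_fun (congrArg s.bot.1 (S.conn.curvature_eq X Y Z)) U
  have hU := congrArg (s.bot.1 Z) (S.conn.curvature_eq X Y U)
  have h1 := S.schouten_weylLow_pair X Y Z U
  have h2 := S.schouten_weylLow_pair X Y U Z
  have hd : (S.curvatureSlot X Y s).1 Z U =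
      (cst (-(2 / 3)) : Fn n M) •
        (sym2 ((S.nablaWeyl X Y - S.nablaWeyl Y X).compr₂ s.mid)).1 Z U
      + (cst 2 : Fn n M) • (sym2 (s.bot.1.flip ∘ₗ S.weylLow X Y)).1 Z U
      + (cst (2 / 3) : Fn n M) •
        (sym2 ((S.weylLow X).compr₂ (s.bot.1 Y) - (S.weylLow Y).compr₂ (s.bot.1 X))).1 Z U := rfl
  rw [S.curvature_eq_sub_weylLow] at hZ hU
  simp only [map_sub, map_smul, LinearMap.sub_apply, LinearMap.smul_apply] at hZ hU
  -- The arguments of the symmetric form `w` are put in the order used by the expanded goal.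
  rw [s.bot.2 (S.weylLow X Y Z) U] at hZ
  rw [s.bot.2 Z X, s.bot.2 Z Y] at hU
  rw [hd, cst_two_smul_sym2, cst_two_thirds_smul_sym2, cst_neg_two_thirds_smul_sym2]
  simp only [LinearConnection.curv, Slots.sub_bot, slotProlongation_mid,
    slotProlongation_bot, LinearConnection.d_add, LinearConnection.d_smul, S.dir_schouten,
    LinearConnection.d_sub, LinearConnection.d_cst_smul, LinearMap.sub_apply, LinearMap.add_apply,
    LinearMap.smul_apply, ← S.conn.nabla_sub_nabla, map_sub,
    Submodule.coe_sub, LinearMap.compr₂_apply, LinearMap.comp_apply, LinearMap.flip_apply,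
    nablaWeyl_apply, h1, h2]
  -- All geometry is now used up; the rest is a formal identity in the atoms introduced by
  -- `generalize`, in which even the value of the coefficient 1/3 plays no role.
  clear h1 h2 hd
  generalize (S.densityConn 2).d = d at *
  generalize S.conn.nabla = D at *
  generalize S.weylLow = T at *
  generalize S.schouten = Q at *
  generalize s.bot.1 = w at *
  generalize s.mid = v at *
  generalize (cst (1 / 3) : Fn n M) = t at *
  linear_combination (norm := skip) h + hZ + hU
  module

/-! ### The prolongation connection applied to `L₀σ`, slot by slot. -/

lemma splitSlots_top (σ : Density n M 2) (X : VF n M) :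
    (S.densityConn 2).d σ X - (cst (1 / 2) : Fn n M) • (S.densityConn 2).d σ X
      - (cst (1 / 2) : Fn n M) • (S.densityConn 2).d σ X = 0 := by
  linear_combination (norm := skip) -two_mul_cst_half (n := n) (M := M) • (S.densityConn 2).d σ X
  module

/-- The bottom slot of `L₀σ` is exactly what this equation forces. -/
lemma splitSlots_mid (σ : Density n M 2) (X Z : VF n M) :
    (S.densityConn 2).d ((cst (1 / 2) : Fn n M) • (S.densityConn 2).d σ Z) X
      - (cst (1 / 2) : Fn n M) • (S.densityConn 2).d σ (S.conn.nabla X Z) + S.schouten X Z • σ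
      - ((cst (1 / 2) : Fn n M) • S.hess σ X Z + S.schouten X Z • σ) = 0 := by
  rw [LinearConnection.d_cst_smul, hess_apply, LinearMap.smul_apply]
  module

set_option maxHeartbeats 2000000 in
lemma splitSlots_bot (σ : Density n M 2) (X Z U : VF n M) :
    (S.densityConn 2).d ((cst (1 / 2) : Fn n M) • S.hess σ Z U + S.schouten Z U • σ) X
      - ((cst (1 / 2) : Fn n M) • S.hess σ (S.conn.nabla X Z) U
        + S.schouten (S.conn.nabla X Z) U • σ)
      - ((cst (1 / 2) : Fn n M) • S.hess σ Z (S.conn.nabla X U)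
        + S.schouten Z (S.conn.nabla X U) • σ)
      + S.schouten X Z • (cst (1 / 2) : Fn n M) • (S.densityConn 2).d σ U
      + S.schouten X U • (cst (1 / 2) : Fn n M) • (S.densityConn 2).d σ Z
      - (cst (1 / 3) : Fn n M) • ((cst (1 / 2) : Fn n M) • (S.densityConn 2).d σ (S.weylLow X Z U)
        + (cst (1 / 2) : Fn n M) • (S.densityConn 2).d σ (S.weylLow X U Z)) =
      (S.bgg σ).1 X Z U := by
  have hXZ := S.thirdDeriv_sub_thirdDeriv σ X Z U
  have hXU := S.thirdDeriv_sub_thirdDeriv σ X U Z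
  have h2 := two_mul_cst_half (n := n) (M := M)
  have h3 := three_mul_cst_third (n := n) (M := M)
  have ht := S.thirdDeriv_apply σ X Z U
  -- Symmetry in the last two arguments rewrites both commutators as differences of the cyclic terms
  -- in `bgg_apply`.
  rw [S.thirdDeriv_symm σ Z X U] at hXZ
  rw [S.thirdDeriv_symm σ X U Z] at hXU
  rw [S.curvature_eq_sub_weylLow] at hXZ hXU
  simp only [map_sub, map_smul, S.schouten_symm U Z] at hXZ hXU
  rw [bgg_apply, LinearConnection.d_add, LinearMap.add_apply, LinearConnection.d_cst_smul,
    LinearMap.smul_apply, LinearConnection.d_smul, S.dir_schouten, S.schouten_symm U X]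
  generalize (cst (1 / 3) : Fn n M) = t at *
  generalize (cst (1 / 2) : Fn n M) = c at *
  generalize (S.densityConn 2).d = d at *
  generalize S.thirdDeriv σ = T at *
  -- The factor `c * t = ½ · ⅓` weights the two commutators in the deviation of `½∇∇∇σ` from its
  -- cyclic mean; `h2` and `h3` encode `2c = 1` and `3t = 1`.
  linear_combination (norm := skip) -c • ht - h2 • S.schouten Z U • d σ X + (c * t) • hXZ + (c * t) • hXU
    - h3 • (c • (T X Z U + (2 : Fn n M) • S.schouten Z U • d σ X + S.schouten X U • d σ Z + S.schouten X Z • d σ U))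
  module

end EinsteinScale

end

end
end ProjTractor

/-! ### Passage from slots back to tractors. -/

open ProjTractor
theorem mainTheorem4 {n : ℕ} (hn : 2 ≤ n) {M : Type*} [TopologicalSpace M]
    [ChartedSpace (EuclideanSpace ℝ (Fin n)) M] [IsManifold (𝓡 n) ∞ M] [T2Space M]
    (p : ProjectiveStructure n M) (S : EinsteinScale p) :
    (∀ σ : Density n M 2, S.prolongationConn.d (S.splitOp₀ σ) = S.splitOp₁ (S.bgg σ)) ∧
    (∀ (X Y : VF n M) (s : SymTractor p),
      S.split (S.prolongationConn.curv X Y s) =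
        { top := 0, mid := 0, bot := S.curvatureSlot X Y (S.split s) }) := by
  refine ⟨fun σ => ?_, fun X Y s => ?_⟩
  · refine LinearMap.ext fun X => ?_
    -- Both sides are images under `S.split.symm` of explicit slots, so it suffices to compare
    -- these.
    change S.split.symm (S.slotProlongation.d (S.split (S.split.symm _)) X) =
      S.split.symm (Slots.insertBot n M _)
    rw [LinearEquiv.apply_symm_apply]
    refine congrArg _ (Slots.ext ?_ (fun Z => ?_) (fun Z U => ?_))
    · rw [S.slotProlongation_top]
      exact S.splitSlots_top σ X
    · rw [S.slotProlongation_mid]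
      exact S.splitSlots_mid σ X Z
    · rw [S.slotProlongation_bot]
      exact S.splitSlots_bot σ X Z U
  · rw [EinsteinScale.prolongationConn, LinearConnection.curv_transport,
      LinearEquiv.apply_symm_apply, LinearEquiv.symm_symm]
    exact Slots.ext (S.slotProlongation_curv_top X Y _)
      (fun Z => S.slotProlongation_curv_mid X Y Z _)
      (fun Z U => S.slotProlongation_curv_bot X Y Z U _)
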